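/- Let $d\ge 1$ and let $J:\mathbb Z^d\times\mathbb Z^d\to[0,\infty)$ be a kernel that is symmetric ($J(x,y)=J(y,x)$), translation invariant ($J(x,y)=J(0,y-x)$) and integrable ($\sum_{x\in\mathbb Z^d}J(0,x)<\infty$). For $\beta\ge 0$ let $\mathbb P_\beta$ be the law of the random graph on $\mathbb Z^d$ in which each edge $\{x,y\}$, $x\ne y$, is present (open) with probability $1-e^{-\beta J(x,y)}$, independently of all other edges. Let $K_0$ be the connected component of the origin in this graph, and let $$\beta_c=\inf\{\beta\ge 0:\mathbb P_\beta(|K_0|=\infty)>0\}\in[0,\infty],\qquad \inf\emptyset=\infty .$$ Assume that $\beta_c<\infty$. Let $\alpha>0$, with $\alpha<1$ if $d=1$, and suppose that there is a constant $C_1<\infty$ such that, with $\|\cdot\|$ the Euclidean norm, $J(x,y)\le C_1\|x-y\|^{-d-\alpha}$ for all $x\ne y$ in $\mathbb Z^d$. Say that the cluster-size exponent exists and equals the real number $\delta\neq 0$ if $\mathbb P_{\beta_c}(|K_0|\ge n)=n^{-1/\delta+o(1)}$ as $n\to\infty$. 1. If the cluster-size exponent exists and equals $\delta$, then $$\delta\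 \ge\ \frac{d+(\alpha\wedge 1)}{d-(\alpha\wedge 1)} .$$ 2. In particular, if $d\in\{1,2\}$ and $\alpha>d/3$, the model does not have mean-field behaviour: it is not the case that the cluster-size exponent exists and equals the mean-field value $2$, i.e. $\mathbb P_{\beta_c}(|K_0|\ge n)=n^{-1/2+o(1)}$ does not hold. -/

import Mathlib

open MeasureTheory Filter
open scoped NNReal ENNReal Topology

/-- The Euclidean norm of an integer vector. -/
noncomputable def euclNorm {d : ℕ} (x : Fin d → ℤ) : ℝ :=
  ‖(WithLp.toLp 2 (fun i => (x i : ℝ)) : EuclideanSpace ℝ (Fin d))‖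

/-- A kernel `J : ℤ^d × ℤ^d → [0, ∞)` that is symmetric, translation invariant and integrable. -/
structure PercolationKernel (d : ℕ) where
  J : (Fin d → ℤ) → (Fin d → ℤ) → ℝ≥0
  symm : ∀ x y, J x y = J y x
  transl : ∀ x y, J x y = J 0 (y - x)
  summable : Summable (fun x => J 0 x)

namespace PercolationKernel

variable {d : ℕ}

/-- The probability `1 - exp (-β J(x,y))` that the edge `{x,y}` is open. -/
noncomputable def edgeProb (K : PercolationKernel d) (β : ℝ≥0) (e : Sym2 (Fin d → ℤ)) :
    unitInterval :=
  Sym2.lift ⟨fun x y => ⟨1 - Real.exp (-((β : ℝ) * (K.J x y : ℝ))),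
      by
        have h : Real.exp (-((β : ℝ) * (K.J x y : ℝ))) ≤ 1 :=
          Real.exp_le_one_iff.mpr (neg_nonpos.mpr (by positivity))
        constructor
        · linarith
        · linarith [Real.exp_pos (-((β : ℝ) * (K.J x y : ℝ)))]⟩,
    fun x y => by simp only [K.symm x y]⟩ e

/-- The law `ℙ_β` of the percolation configuration: independent edges `e`, each of which is open
(`true`) with probability `K.edgeProb β e`. (The index set contains the loops `s(x, x)` too; they
are independent of all other edges and are ignored by `openGraph` below.) -/
noncomputable def law (K : PercolationKernel d) (β : ℝ≥0) :
    Measure (Sym2 (Fin d → ℤ) → Bool) :=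
  Measure.infinitePi (fun e => ProbabilityTheory.bernoulliMeasure true false (K.edgeProb β e))

end PercolationKernel

/-- The random graph formed by the open edges of a configuration. -/
def openGraph {d : ℕ} (ω : Sym2 (Fin d → ℤ) → Bool) : SimpleGraph (Fin d → ℤ) where
  Adj x y := x ≠ y ∧ ω s(x, y) = true
  symm := ⟨fun x y h => ⟨h.1.symm, by rw [Sym2.eq_swap]; exact h.2⟩⟩
  loopless := ⟨fun _ h => h.1 rfl⟩

/-- The cluster `K_x`: all vertices joined to `x` by an open path. -/
def cluster {d : ℕ} (ω : Sym2 (Fin d → ℤ) → Bool) (x : Fin d → ℤ) : Set (Fin d → ℤ) :=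
  {y | (openGraph ω).Reachable x y}

/-- `f(n) ≈ n^c`, that is, `f(n) = n^{c + o(1)}` as `n → ∞`. -/
def ApproxPow (f : ℕ → ℝ) (c : ℝ) : Prop :=
  ∃ ε : ℕ → ℝ, Tendsto ε atTop (𝓝 0) ∧ ∀ᶠ n : ℕ in atTop, f n = (n : ℝ) ^ (c + ε n)

namespace PercolationKernel

variable {d : ℕ}

/-- The tail `ℙ_β(|K_0| ≥ n)` of the size of the cluster of the origin. -/
noncomputable def clusterTail (K : PercolationKernel d) (β : ℝ≥0) (n : ℕ) : ℝ :=
  (K.law β).real {ω | (n : ℕ∞) ≤ (cluster ω 0).encard}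

/-- The critical parameter `β_c = inf {β ≥ 0 : ℙ_β(|K_0| = ∞) > 0}`, with `inf ∅ = ∞`. -/
noncomputable def criticalParameter (K : PercolationKernel d) : ℝ≥0∞ :=
  ⨅ β ∈ {β : ℝ≥0 | 0 < K.law β {ω | (cluster ω 0).Infinite}}, (β : ℝ≥0∞)

/-- `δ` is the cluster-size exponent at parameter `β`: `ℙ_β(|K_0| ≥ n) ≈ n^{-1/δ}`. -/
def IsClusterExponent (K : PercolationKernel d) (β : ℝ≥0) (δ : ℝ) : Prop :=
  δ ≠ 0 ∧ ApproxPow (K.clusterTail β) (-1 / δ)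

/-- Mean-field behaviour of the cluster size: the exponent exists and has its mean-field
value `2`. -/
def HasMeanFieldExponent (K : PercolationKernel d) (β : ℝ≥0) : Prop :=
  K.IsClusterExponent β 2

end PercolationKernel

/-!
The proof compares the isoperimetry of a box with the size of its clusters.

*Lower bound on clusters in a box.* For a finite set `S` and `o ∈ S`, the exit sum of `(S, o)` is
the mean of the total weight `β J` of the edges that leave `S` from the cluster of `o` inside `S`.
By the argument of Duminil-Copin and Tassion, an exit sum less than `1` makes the mean cluster size
finite (`meanSize_le_of_exit_le`). Exit sums are continuous in `β`, so at `β_c` all of them are at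
least `1` (`PercolationKernel.one_le_exitSum`). Averaging this over all `o` in a box of side `N`
whose edge boundary has weight of order at most `N^{d-s}`, which holds for every `s < min α 1`,
shows that some vertex of the box has mean cluster size inside the box at least of order `N^s`
(`PercolationKernel.rpow_le_of_meanSize_box_le`).

*Upper bound on clusters in a box.* Suppose that `ℙ(|K_0| ≥ n)` is at most of order `n^{-a}` with
`a < 1`. The expected number of vertices of the box in clusters of size at least `M` is at most of
order `N^d M^{-a}`, so by Markov's inequality such a cluster exists with probability at most of
order `N^d M^{-1-a}`. If `M = N^m` with `m > d / (1 + a)`, this is a negative power of `N`. A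
cluster of size `3 n` splits into two edge-disjoint connected pieces of size `n`
(`HasLargeCluster.disjoint_occurrence`), so by the van den Berg–Kesten inequality
(`prob_disjoint_occurrence_le`) the probability is squared whenever the size is tripled. After
boundedly many triplings it is less than `N^{-d}`, and larger clusters can be ignored. Therefore
the mean cluster sizes inside the box are at most of order `M^{1-a} = N^{m(1-a)}`
(`PercolationKernel.exists_meanSize_box_le`).

Together the two bounds give `s ≤ d (1 - a) / (1 + a)`, which in the limits `s → min α 1` and
`a → 1 / δ` is the claimed inequality.

All probabilistic arguments take place in finite volume, where the open edges form a random subset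
of a finite set and probabilities are finite sums (`expect`, `prob`); `law_real_openEdges` is the
link to the infinite product measure.
-/

/-! ### Finite product measures and the van den Berg–Kesten inequality -/

section FiniteProduct

variable {ι : Type*} [DecidableEq ι]

/-- The expectation of `f X`, where `X` is the random subset of the finite set `F` that contains
each `e ∈ F` with probability `p e`, independently. -/
noncomputable def expect (p : ι → ℝ) (F : Finset ι) (f : Finset ι → ℝ) : ℝ :=
  ∑ X ∈ F.powerset, (∏ e ∈ X, p e) * (∏ e ∈ F \ X, (1 - p e)) * f X

open Classical in
/-- The probability of the event `P` for the random subset of `F` described in `expect`. -/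
noncomputable def prob (p : ι → ℝ) (F : Finset ι) (P : Finset ι → Prop) : ℝ :=
  expect p F (fun X => if P X then 1 else 0)

theorem expect_empty (p : ι → ℝ) (f : Finset ι → ℝ) : expect p ∅ f = f ∅ := by
  simp [expect]

theorem expect_insert (p : ι → ℝ) {F : Finset ι} {e : ι} (he : e ∉ F) (f : Finset ι → ℝ) :
    expect p (insert e F) f
      = (1 - p e) * expect p F f + p e * expect p F (fun X => f (insert e X)) := by
  unfold expect
  rw [Finset.sum_powerset_insert he, Finset.mul_sum, Finset.mul_sum]
  congr 1 <;> refine Finset.sum_congr rfl fun X hX => ?_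
  · have hX' : e ∉ X := fun h => he (Finset.mem_powerset.1 hX h)
    rw [Finset.insert_sdiff_of_notMem _ hX', Finset.prod_insert (by simp [he])]
    ring
  · have hX' : e ∉ X := fun h => he (Finset.mem_powerset.1 hX h)
    rw [Finset.prod_insert hX', Finset.insert_sdiff_insert,
      Finset.sdiff_insert_of_notMem he]
    ring

theorem expect_congr {p : ι → ℝ} {F : Finset ι} {f g : Finset ι → ℝ}
    (h : ∀ X ⊆ F, f X = g X) : expect p F f = expect p F g :=
  Finset.sum_congr rfl fun X hX => by rw [h X (Finset.mem_powerset.1 hX)]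

theorem expect_mono {p : ι → ℝ} (hp : ∀ e, p e ∈ Set.Icc (0 : ℝ) 1) {F : Finset ι}
    {f g : Finset ι → ℝ} (h : ∀ X ⊆ F, f X ≤ g X) : expect p F f ≤ expect p F g :=
  Finset.sum_le_sum fun X hX => mul_le_mul_of_nonneg_left (h X (Finset.mem_powerset.1 hX))
    (mul_nonneg (Finset.prod_nonneg fun e _ => (hp e).1)
      (Finset.prod_nonneg fun e _ => sub_nonneg.2 (hp e).2))

theorem expect_add (p : ι → ℝ) (F : Finset ι) (f g : Finset ι → ℝ) :
    expect p F (fun X => f X + g X) = expect p F f + expect p F g := by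
  simp only [expect, mul_add, Finset.sum_add_distrib]

theorem expect_const_mul (p : ι → ℝ) (F : Finset ι) (c : ℝ) (f : Finset ι → ℝ) :
    expect p F (fun X => c * f X) = c * expect p F f := by
  simp only [expect, Finset.mul_sum]
  exact Finset.sum_congr rfl fun X _ => by ring

theorem expect_sum {κ : Type*} (p : ι → ℝ) (F : Finset ι) (s : Finset κ)
    (f : κ → Finset ι → ℝ) :
    expect p F (fun X => ∑ k ∈ s, f k X) = ∑ k ∈ s, expect p F (f k) := by
  simp only [expect, Finset.mul_sum]
  exact Finset.sum_comm

theorem expect_const (p : ι → ℝ) (F : Finset ι) (c : ℝ) : expect p F (fun _ => c) = c := by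
  induction F using Finset.induction_on with
  | empty => exact expect_empty p _
  | insert e F he ih => rw [expect_insert p he, ih]; ring

/-- The restriction of the random subset of `F` to `F' ⊆ F` is the random subset of `F'`. -/
theorem expect_inter (p : ι → ℝ) {F F' : Finset ι} (h : F' ⊆ F) (f : Finset ι → ℝ) :
    expect p F (fun X => f (X ∩ F')) = expect p F' f := by
  obtain ⟨G, hG, rfl⟩ : ∃ G, Disjoint F' G ∧ F = G ∪ F' :=
    ⟨F \ F', Finset.disjoint_sdiff, by rw [Finset.sdiff_union_of_subset h]⟩
  clear h
  induction G using Finset.induction_on with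
  | empty =>
    rw [Finset.empty_union]
    exact expect_congr fun X hX => by rw [Finset.inter_eq_left.2 hX]
  | insert e G he ih =>
    rw [Finset.disjoint_insert_right] at hG
    rw [Finset.insert_union, expect_insert p (by simp [he, hG.1]), ih hG.2]
    simp only [Finset.insert_inter_of_notMem hG.1, ih hG.2]
    ring

theorem expect_map {κ : Type*} [DecidableEq κ] (p : κ → ℝ) (τ : ι ↪ κ) (F : Finset ι)
    (f : Finset κ → ℝ) :
    expect p (F.map τ) f = expect (fun e => p (τ e)) F (fun X => f (X.map τ)) := by
  induction F using Finset.induction_on generalizing f with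
  | empty => simp [expect_empty]
  | insert e F he ih =>
    rw [Finset.map_insert, expect_insert p (by simpa using he), expect_insert _ he, ih, ih]
    simp only [Finset.map_insert]

theorem prob_mono {p : ι → ℝ} (hp : ∀ e, p e ∈ Set.Icc (0 : ℝ) 1) {F : Finset ι}
    {P Q : Finset ι → Prop} (h : ∀ X ⊆ F, P X → Q X) : prob p F P ≤ prob p F Q := by
  refine expect_mono hp fun X hX => ?_
  have := h X hX
  split_ifs <;> first | tauto | norm_num

theorem prob_congr {p : ι → ℝ} {F : Finset ι} {P Q : Finset ι → Prop}
    (h : ∀ X ⊆ F, (P X ↔ Q X)) : prob p F P = prob p F Q :=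
  expect_congr fun X hX => by classical exact if_congr (h X hX) rfl rfl

theorem prob_nonneg {p : ι → ℝ} (hp : ∀ e, p e ∈ Set.Icc (0 : ℝ) 1) (F : Finset ι)
    (P : Finset ι → Prop) : 0 ≤ prob p F P := by
  rw [← expect_const p F 0]
  exact expect_mono hp fun X _ => by split_ifs <;> norm_num

theorem prob_le_one {p : ι → ℝ} (hp : ∀ e, p e ∈ Set.Icc (0 : ℝ) 1) (F : Finset ι)
    (P : Finset ι → Prop) : prob p F P ≤ 1 := by
  rw [← expect_const p F 1]
  exact expect_mono hp fun X _ => by split_ifs <;> norm_num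

theorem prob_exists_le {κ : Type*} {p : ι → ℝ} (hp : ∀ e, p e ∈ Set.Icc (0 : ℝ) 1)
    (F : Finset ι) (s : Finset κ) (P : κ → Finset ι → Prop) :
    prob p F (fun X => ∃ k ∈ s, P k X) ≤ ∑ k ∈ s, prob p F (P k) := by
  unfold prob
  rw [← expect_sum]
  refine expect_mono hp fun X _ => ?_
  split_ifs with h
  · obtain ⟨k, hk, hP⟩ := h
    refine le_trans (by simp [hP]) (Finset.single_le_sum (fun i _ => ?_) hk)
    split_ifs <;> norm_num
  · exact Finset.sum_nonneg fun i _ => by split_ifs <;> norm_num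

open Classical in
theorem prob_inter (p : ι → ℝ) {F F' : Finset ι} (h : F' ⊆ F) (P : Finset ι → Prop) :
    prob p F (fun X => P (X ∩ F')) = prob p F' P :=
  expect_inter p h (fun X => if P X then 1 else 0)

theorem prob_mem (p : ι → ℝ) {F : Finset ι} {e : ι} (he : e ∈ F) :
    prob p F (fun X => e ∈ X) = p e := by
  have h := prob_inter p (Finset.singleton_subset_iff.2 he) (fun X => e ∈ X)
  simp only [Finset.mem_inter, Finset.mem_singleton, and_true] at h
  rw [h, prob, ← insert_empty_eq, expect_insert p (Finset.notMem_empty e)]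
  simp [expect_empty]

/-- The van den Berg–Kesten inequality in the form in which it is proved by induction on `F`: an
increasing property `G` of *pairs* of configurations is less likely to hold for two disjoint
subsets of one random set than for two independent random sets. -/
theorem expect_disjoint_pair_le {p : ι → ℝ} (hp : ∀ e, p e ∈ Set.Icc (0 : ℝ) 1) (F : Finset ι)
    (G : Finset ι → Finset ι → Prop)
    (hG : ∀ I J I' J', I ⊆ I' → J ⊆ J' → G I J → G I' J') :
    prob p F (fun X => ∃ I J, I ⊆ X ∧ J ⊆ X ∧ Disjoint I J ∧ G I J)
      ≤ expect p F (fun X => prob p F (G X)) := by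
  classical
  induction F using Finset.induction_on generalizing G with
  | empty =>
    simp only [prob, expect_empty, Finset.subset_empty]
    refine le_of_eq (if_congr ⟨?_, fun h => ⟨∅, ∅, rfl, rfl, disjoint_bot_left, h⟩⟩ rfl rfl)
    rintro ⟨I, J, rfl, rfl, -, h⟩
    exact h
  | insert e F he ih =>
    have hG' : ∀ I J I' J', I ⊆ I' → J ⊆ J' →
        (G (insert e I) J ∨ G I (insert e J)) → (G (insert e I') J' ∨ G I' (insert e J')) := by
      rintro I J I' J' hI hJ (h | h)
      · exact Or.inl (hG _ _ _ _ (Finset.insert_subset_insert _ hI) hJ h)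
      · exact Or.inr (hG _ _ _ _ hI (Finset.insert_subset_insert _ hJ) h)
    have h0 := ih G hG
    have h1 := ih _ hG'
    -- An open edge `e` can be used by at most one of the two disjoint subsets.
    have key : ∀ X, (∃ I J, I ⊆ insert e X ∧ J ⊆ insert e X ∧ Disjoint I J ∧ G I J) →
        ∃ I J, I ⊆ X ∧ J ⊆ X ∧ Disjoint I J ∧ (G (insert e I) J ∨ G I (insert e J)) := by
      rintro X ⟨I, J, hI, hJ, hIJ, h⟩
      refine ⟨I.erase e, J.erase e, Finset.subset_insert_iff.1 hI, Finset.subset_insert_iff.1 hJ,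
        hIJ.mono (Finset.erase_subset _ _) (Finset.erase_subset _ _), ?_⟩
      by_cases heI : e ∈ I
      · have heJ : e ∉ J := Finset.disjoint_left.1 hIJ heI
        left
        rwa [Finset.insert_erase heI, Finset.erase_eq_of_notMem heJ]
      · right
        rw [Finset.erase_eq_of_notMem heI]
        exact hG _ _ _ _ subset_rfl (by
          intro a ha
          by_cases hae : a = e <;> simp [hae, ha]) h
    have hp0 := (hp e).1
    have hp1 := sub_nonneg.2 (hp e).2
    calc prob p (insert e F) (fun X => ∃ I J, I ⊆ X ∧ J ⊆ X ∧ Disjoint I J ∧ G I J)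
        ≤ (1 - p e) * prob p F (fun X => ∃ I J, I ⊆ X ∧ J ⊆ X ∧ Disjoint I J ∧ G I J)
          + p e * prob p F (fun X => ∃ I J, I ⊆ X ∧ J ⊆ X ∧ Disjoint I J ∧
              (G (insert e I) J ∨ G I (insert e J))) := by
          rw [prob, expect_insert p he]
          exact add_le_add le_rfl
            (mul_le_mul_of_nonneg_left (prob_mono hp fun X _ => key X) hp0)
      _ ≤ (1 - p e) * expect p F (fun X => prob p F (G X))
          + p e * expect p F (fun X => prob p F
              (fun Y => G (insert e X) Y ∨ G X (insert e Y))) := by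
          gcongr
      _ ≤ expect p (insert e F) (fun X => prob p (insert e F) (G X)) := by
          -- On the right-hand side the edge `e` has two independent states, one for `X` and one
          -- for `Y`; the comparison holds for all fixed states of the other edges.
          have hpt : ∀ X Y : Finset ι,
              (1 - p e) * (if G X Y then 1 else 0)
                + p e * (if G (insert e X) Y ∨ G X (insert e Y) then 1 else 0)
              ≤ (1 - p e) * ((1 - p e) * (if G X Y then 1 else 0)
                  + p e * (if G X (insert e Y) then 1 else 0))
                + p e * ((1 - p e) * (if G (insert e X) Y then 1 else 0)
                  + p e * (if G (insert e X) (insert e Y) then (1 : ℝ) else 0)) := by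
            intro X Y
            have i1 : G X Y → G (insert e X) Y :=
              hG _ _ _ _ (Finset.subset_insert _ _) subset_rfl
            have i2 : G X Y → G X (insert e Y) :=
              hG _ _ _ _ subset_rfl (Finset.subset_insert _ _)
            have i3 : G (insert e X) Y → G (insert e X) (insert e Y) :=
              hG _ _ _ _ subset_rfl (Finset.subset_insert _ _)
            have i4 : G X (insert e Y) → G (insert e X) (insert e Y) :=
              hG _ _ _ _ (Finset.subset_insert _ _) subset_rfl
            by_cases g0 : G X Y
            · simp only [g0, i1 g0, i2 g0, i3 (i1 g0), or_self, if_true]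
              nlinarith
            · by_cases g1 : G (insert e X) Y <;> by_cases g2 : G X (insert e Y)
              · simp only [g0, g1, g2, i3 g1, or_self, if_true, if_false]
                nlinarith [mul_nonneg hp0 hp1]
              · simp only [g0, g1, g2, i3 g1, or_false, if_true, if_false]
                nlinarith
              · simp only [g0, g1, g2, i4 g2, false_or, if_true, if_false]
                nlinarith
              · simp only [g0, g1, g2, or_self, if_false, mul_zero, add_zero, zero_add]
                split_ifs <;> nlinarith [mul_nonneg hp0 hp0]
          unfold prob
          rw [expect_insert p he]
          simp only [expect_insert p he]
          rw [← expect_const_mul, ← expect_const_mul, ← expect_const_mul, ← expect_const_mul,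
            ← expect_add, ← expect_add]
          refine expect_mono hp fun X _ => ?_
          simp only [← expect_const_mul, ← expect_add]
          refine expect_mono hp fun Y _ => ?_
          convert hpt X Y

/-- The van den Berg–Kesten inequality for increasing events. -/
theorem prob_disjoint_occurrence_le {p : ι → ℝ} (hp : ∀ e, p e ∈ Set.Icc (0 : ℝ) 1)
    (F : Finset ι) {A B : Finset ι → Prop} (hA : ∀ I I', I ⊆ I' → A I → A I')
    (hB : ∀ I I', I ⊆ I' → B I → B I') :
    prob p F (fun X => ∃ I J, I ⊆ X ∧ J ⊆ X ∧ Disjoint I J ∧ A I ∧ B J)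
      ≤ prob p F A * prob p F B := by
  classical
  refine (expect_disjoint_pair_le hp F (fun I J => A I ∧ B J)
    fun I J I' J' hI hJ h => ⟨hA _ _ hI h.1, hB _ _ hJ h.2⟩).trans (le_of_eq ?_)
  rw [mul_comm]
  conv_rhs => rw [prob, prob, ← expect_const_mul]
  refine expect_congr fun X _ => ?_
  unfold prob
  by_cases h : A X
  · simp [h]
  · simp [h, expect_const]

end FiniteProduct

/-! ### Finite clusters and the splitting of a large cluster -/

section Clusters

variable {V : Type*}

/-- `x` and `y` are joined by a path of edges of `X`. (Loops in `X` are harmless.) -/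
def Conn (X : Finset (Sym2 V)) (x y : V) : Prop :=
  Relation.ReflTransGen (fun a b => s(a, b) ∈ X) x y

theorem Conn.refl (X : Finset (Sym2 V)) (x : V) : Conn X x x := Relation.ReflTransGen.refl

theorem Conn.trans {X : Finset (Sym2 V)} {x y z : V} (h : Conn X x y) (h' : Conn X y z) :
    Conn X x z := Relation.ReflTransGen.trans h h'

theorem Conn.single {X : Finset (Sym2 V)} {x y : V} (h : s(x, y) ∈ X) : Conn X x y :=
  Relation.ReflTransGen.single h

theorem Conn.symm {X : Finset (Sym2 V)} {x y : V} (h : Conn X x y) : Conn X y x :=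
  by
  induction h with
  | refl => exact Conn.refl _ _
  | tail _ hbc ih => exact (Conn.single (by rwa [Sym2.eq_swap])).trans ih

theorem Conn.comm {X : Finset (Sym2 V)} {x y : V} : Conn X x y ↔ Conn X y x :=
  ⟨Conn.symm, Conn.symm⟩

theorem Conn.mono {X Y : Finset (Sym2 V)} (h : X ⊆ Y) {x y : V} (hc : Conn X x y) :
    Conn Y x y := by
  induction hc with
  | refl => exact Conn.refl _ _
  | tail _ hbc ih => exact ih.trans (Conn.single (h hbc))

open Classical in
/-- The vertices of the finite set `S` that are joined to `x` by edges of `X`. -/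
noncomputable def finCluster (X : Finset (Sym2 V)) (S : Finset V) (x : V) : Finset V :=
  S.filter (Conn X x)

theorem mem_finCluster {X : Finset (Sym2 V)} {S : Finset V} {x y : V} :
    y ∈ finCluster X S x ↔ y ∈ S ∧ Conn X x y := by
  simp [finCluster]

theorem finCluster_subset (X : Finset (Sym2 V)) (S : Finset V) (x : V) : finCluster X S x ⊆ S :=
  fun _ hy => (mem_finCluster.1 hy).1

theorem finCluster_mono {X Y : Finset (Sym2 V)} (h : X ⊆ Y) (S : Finset V) (x : V) :
    finCluster X S x ⊆ finCluster Y S x := fun _ hy =>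
  mem_finCluster.2 ⟨(mem_finCluster.1 hy).1, (mem_finCluster.1 hy).2.mono h⟩

theorem Conn.mem_of_subset_sym2 {X : Finset (Sym2 V)} {S : Finset V} (hX : X ⊆ S.sym2) {x y : V}
    (h : Conn X x y) (hx : x ∈ S) : y ∈ S := by
  induction h with
  | refl => exact hx
  | tail _ hbc _ => exact (Finset.mk_mem_sym2_iff.1 (hX hbc)).2

/-- Some cluster of the graph with edge set `X` on the vertex set `S` has at least `n` vertices. -/
def HasLargeCluster (S : Finset V) (n : ℕ) (X : Finset (Sym2 V)) : Prop :=
  ∃ x ∈ S, n ≤ (finCluster X S x).card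

theorem HasLargeCluster.mono {S : Finset V} {n : ℕ} (X Y : Finset (Sym2 V)) (h : X ⊆ Y)
    (hX : HasLargeCluster S n X) : HasLargeCluster S n Y := by
  obtain ⟨x, hx, hn⟩ := hX
  exact ⟨x, hx, hn.trans (Finset.card_le_card (finCluster_mono h S x))⟩

variable [DecidableEq V]

theorem Conn.erase_loop {X : Finset (Sym2 V)} {x y : V} (h : Conn X x y) (v : V) :
    Conn (X.erase s(v, v)) x y := by
  induction h with
  | refl => exact Conn.refl _ _
  | @tail b c _ hbc ih =>
    by_cases e : s(b, c) = s(v, v)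
    · rcases Sym2.eq_iff.1 e with ⟨rfl, rfl⟩ | ⟨rfl, rfl⟩ <;> exact ih
    · exact ih.trans (Conn.single (Finset.mem_erase.2 ⟨e, hbc⟩))

/-- Every vertex of `A` is joined to `v` by edges of `X` inside `A`. -/
def ConnTo (X : Finset (Sym2 V)) (A : Finset V) (v : V) : Prop :=
  ∀ x ∈ A, Conn (X ∩ A.sym2) x v

theorem Conn.mono_sym2 {X : Finset (Sym2 V)} {A B : Finset V} (h : A ⊆ B) {x y : V}
    (hc : Conn (X ∩ A.sym2) x y) : Conn (X ∩ B.sym2) x y :=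
  hc.mono (Finset.inter_subset_inter_left (Finset.sym2_mono h))

theorem ConnTo.union {X : Finset (Sym2 V)} {A B : Finset V} {v : V} (hA : ConnTo X A v)
    (hB : ConnTo X B v) : ConnTo X (A ∪ B) v := by
  intro x hx
  rcases Finset.mem_union.1 hx with h | h
  · exact (hA x h).mono_sym2 Finset.subset_union_left
  · exact (hB x h).mono_sym2 Finset.subset_union_right

theorem connTo_finCluster (X : Finset (Sym2 V)) {S : Finset V} (hX : X ⊆ S.sym2) {x : V}
    (hx : x ∈ S) : ConnTo X (finCluster X S x) x := by
  intro y hy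
  have h : Conn X x y := (mem_finCluster.1 hy).2
  apply Conn.symm
  clear hy
  induction h with
  | refl => exact Conn.refl _ _
  | @tail b c hxb hbc ih =>
    have hxb' : Conn X x b := hxb
    refine ih.trans (Conn.single (Finset.mem_inter.2 ⟨hbc, Finset.mk_mem_sym2_iff.2 ?_⟩))
    exact ⟨mem_finCluster.2 ⟨hxb'.mem_of_subset_sym2 hX hx, hxb'⟩,
      mem_finCluster.2 ⟨(Finset.mk_mem_sym2_iff.1 (hX hbc)).2, hxb'.trans (Conn.single hbc)⟩⟩

/-- If `A` is connected, then a union of components of `A \ {v}`, together with `v`, is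
connected. -/
theorem ConnTo.insert_of_closed {X : Finset (Sym2 V)} {A U : Finset V} {v : V}
    (hA : ConnTo X A v) (hU : U ⊆ A.erase v)
    (hcl : ∀ a ∈ U, ∀ b ∈ A.erase v, s(a, b) ∈ X → b ∈ U) : ConnTo X (insert v U) v := by
  intro x hx
  rcases Finset.mem_insert.1 hx with rfl | hxU
  · exact Conn.refl _ _
  have h := hA x (Finset.mem_of_mem_erase (hU hxU))
  clear hx
  induction h using Relation.ReflTransGen.head_induction_on with
  | refl => exact Conn.refl _ _
  | @head a c hac _ ih =>
    obtain ⟨hX, hs⟩ := Finset.mem_inter.1 hac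
    have hcU : c = v ∨ c ∈ U := by
      by_cases hc : c = v
      · exact Or.inl hc
      · exact Or.inr (hcl a hxU c
          (Finset.mem_erase.2 ⟨hc, (Finset.mk_mem_sym2_iff.1 hs).2⟩) hX)
    have hstep : Conn (X ∩ (insert v U).sym2) a c := Conn.single (Finset.mem_inter.2
      ⟨hX, Finset.mk_mem_sym2_iff.2 ⟨by simp [hxU], by simpa using hcU⟩⟩)
    rcases hcU with rfl | hcU
    · exact hstep
    · exact hstep.trans (ih hcU)

theorem ConnTo.exists_neighbor {X : Finset (Sym2 V)} {A : Finset V} {v x : V}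
    (hA : ConnTo X A v) (hx : x ∈ A) (hxv : x ≠ v) : ∃ w ∈ A.erase v, s(w, v) ∈ X := by
  have h := hA x hx
  clear hx
  induction h using Relation.ReflTransGen.head_induction_on with
  | refl => exact absurd rfl hxv
  | @head a c hac _ ih =>
    by_cases hc : c = v
    · subst hc
      obtain ⟨hX, hs⟩ := Finset.mem_inter.1 hac
      exact ⟨a, Finset.mem_erase.2 ⟨hxv, (Finset.mk_mem_sym2_iff.1 hs).1⟩, hX⟩
    · exact ih hc

/-- If `C ∪ D` is a partition of `A \ {v}`, the part `D` can be moved from `A` to `B`, with `v`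
remaining the only common vertex. -/
theorem move_components {A B C D : Finset V} {v : V} (hv : A ∩ B = {v})
    (hCD : C ∪ D = A.erase v) (hdis : Disjoint C D) :
    insert v C ∪ (B ∪ insert v D) = A ∪ B ∧ insert v C ∩ (B ∪ insert v D) = {v} := by
  have hvA : v ∈ A ∩ B := by rw [hv]; exact Finset.mem_singleton_self v
  obtain ⟨hvA, hvB⟩ := Finset.mem_inter.1 hvA
  have hA : A = insert v (C ∪ D) := by rw [hCD, Finset.insert_erase hvA]
  constructor
  · rw [hA]
    ext a
    simp only [Finset.mem_union, Finset.mem_insert]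
    tauto
  · ext a
    simp only [Finset.mem_inter, Finset.mem_singleton]
    constructor
    · rintro ⟨h1, h2⟩
      rcases Finset.mem_insert.1 h1 with h | hC
      · exact h
      have haA : a ∈ A := Finset.mem_of_mem_erase (hCD.subset (Finset.mem_union_left _ hC))
      rcases Finset.mem_union.1 h2 with hB | hD
      · exact Finset.mem_singleton.1 (hv.subset (Finset.mem_inter.2 ⟨haA, hB⟩))
      · rcases Finset.mem_insert.1 hD with h | hD
        · exact h
        · exact absurd hD (Finset.disjoint_left.1 hdis hC)
    · rintro rfl
      exact ⟨Finset.mem_insert_self _ _, Finset.mem_union_left _ hvB⟩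

/-- A connected set `W = A ∪ B`, where the connected sets `A` and `B` share only `v`, has such a
decomposition with both parts of size at least `n`, provided that `3 n ≤ |W|` and `n ≤ |A|`: as
long as `A` is too large, either `v` is moved to one of its neighbours in `A`, or components of
`A \ {v}` are moved to `B`. -/
theorem exists_balanced_split (X : Finset (Sym2 V)) (W : Finset V) {n : ℕ} (hn : 1 ≤ n)
    (hW : 3 * n ≤ W.card) : ∀ (k : ℕ) (A B : Finset V) (v : V), A.card = k → A ∪ B = W →
      A ∩ B = {v} → ConnTo X A v → ConnTo X B v → n ≤ A.card →
      ∃ (A' B' : Finset V) (v' : V), A' ∪ B' = W ∧ A' ∩ B' = {v'} ∧ ConnTo X A' v' ∧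
        ConnTo X B' v' ∧ n ≤ A'.card ∧ n ≤ B'.card := by
  classical
  intro k
  induction k using Nat.strong_induction_on with
  | _ k ih =>
    intro A B v hk hAB hv hA hB hnA
    have hcard := Finset.card_union_add_card_inter A B
    rw [hAB, hv, Finset.card_singleton] at hcard
    by_cases hsmall : A.card ≤ 2 * n
    · exact ⟨A, B, v, hAB, hv, hA, hB, hnA, by omega⟩
    have hvAB : v ∈ A ∩ B := by rw [hv]; exact Finset.mem_singleton_self v
    obtain ⟨hvA, hvB⟩ := Finset.mem_inter.1 hvAB
    have hdis : ∀ a ∈ A, a ∈ B → a = v := fun a ha hb => by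
      have : a ∈ A ∩ B := Finset.mem_inter.2 ⟨ha, hb⟩
      rwa [hv, Finset.mem_singleton] at this
    have hA0 : (A.erase v).card + 1 = A.card := Finset.card_erase_add_one hvA
    obtain ⟨x, hx⟩ : (A.erase v).Nonempty := Finset.card_pos.1 (by omega)
    obtain ⟨w, hw, hwX⟩ := hA.exists_neighbor (Finset.mem_of_mem_erase hx)
      (Finset.ne_of_mem_erase hx)
    have hwv := Finset.ne_of_mem_erase hw
    have hwA := Finset.mem_of_mem_erase hw
    set C := finCluster (X ∩ (A.erase v).sym2) (A.erase v) w with hC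
    have hCsub : C ⊆ A.erase v := finCluster_subset _ _ _
    have hwC : w ∈ C := mem_finCluster.2 ⟨hw, Conn.refl _ _⟩
    -- If `A \ {v}` is connected, `w` takes the place of `v`; otherwise one of `C` and `D` is moved.
    by_cases hCA : C = A.erase v
    · refine ih (A.erase v).card (by omega) (A.erase v) (insert w B) w rfl ?_ ?_ ?_ ?_ (by omega)
      · rw [← hAB]
        ext a
        simp only [Finset.mem_union, Finset.mem_erase, Finset.mem_insert]
        by_cases hav : a = v
        · subst hav; simp [hvA, hvB]
        · by_cases haw : a = w
          · subst haw; simp [hwA]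
          · simp [hav, haw]
      · ext a
        simp only [Finset.mem_inter, Finset.mem_erase, Finset.mem_insert, Finset.mem_singleton]
        constructor
        · rintro ⟨⟨h1, h2⟩, rfl | h3⟩
          · rfl
          · exact absurd (hdis a h2 h3) h1
        · rintro rfl
          exact ⟨⟨hwv, hwA⟩, Or.inl rfl⟩
      · intro y hy
        rw [← hCA] at hy
        exact (mem_finCluster.1 hy).2.symm
      · intro y hy
        rcases Finset.mem_insert.1 hy with rfl | hyB
        · exact Conn.refl _ _
        · refine ((hB y hyB).mono_sym2 (Finset.subset_insert _ _)).trans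
            (Conn.symm (Conn.single (Finset.mem_inter.2 ⟨hwX, Finset.mk_mem_sym2_iff.2 ?_⟩)))
          exact ⟨Finset.mem_insert_self _ _, Finset.mem_insert_of_mem hvB⟩
    · set D := A.erase v \ C with hD
      have hDsub : D ⊆ A.erase v := Finset.sdiff_subset
      have hDne : D.Nonempty := by
        rw [Finset.nonempty_iff_ne_empty]
        intro h
        exact hCA (hCsub.antisymm (Finset.sdiff_eq_empty_iff_subset.1 h))
      have hCcl : ∀ a ∈ C, ∀ b ∈ A.erase v, s(a, b) ∈ X → b ∈ C := by
        intro a ha b hb hab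
        obtain ⟨ha1, ha2⟩ := mem_finCluster.1 ha
        exact mem_finCluster.2 ⟨hb, ha2.trans (Conn.single (Finset.mem_inter.2
          ⟨hab, Finset.mk_mem_sym2_iff.2 ⟨ha1, hb⟩⟩))⟩
      have hDcl : ∀ a ∈ D, ∀ b ∈ A.erase v, s(a, b) ∈ X → b ∈ D := by
        intro a ha b hb hab
        refine Finset.mem_sdiff.2 ⟨hb, fun hbC => (Finset.mem_sdiff.1 ha).2 ?_⟩
        exact hCcl b hbC a (hDsub ha) (by rwa [Sym2.eq_swap])
      have hvC : v ∉ C := fun h => Finset.notMem_erase v A (hCsub h)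
      have hvD : v ∉ D := fun h => Finset.notMem_erase v A (hDsub h)
      have hCD : D.card + C.card = (A.erase v).card := Finset.card_sdiff_add_card_eq_card hCsub
      have hCpos : 0 < C.card := Finset.card_pos.2 ⟨w, hwC⟩
      have hDpos : 0 < D.card := hDne.card_pos
      have hC1 := hA.insert_of_closed hCsub hCcl
      have hD1 := hA.insert_of_closed hDsub hDcl
      have hCc : (insert v C).card = C.card + 1 := Finset.card_insert_of_notMem hvC
      have hDc : (insert v D).card = D.card + 1 := Finset.card_insert_of_notMem hvD
      have hCu : C ∪ D = A.erase v := Finset.union_sdiff_of_subset hCsub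
      have hCd : Disjoint C D := Finset.disjoint_sdiff
      by_cases hbig : n ≤ (insert v C).card
      · obtain ⟨hu, hi⟩ := move_components hv hCu hCd
        exact ih (insert v C).card (by omega) (insert v C) (B ∪ insert v D) v rfl
          (hu.trans hAB) hi hC1 (hB.union hD1) hbig
      · obtain ⟨hu, hi⟩ := move_components hv ((Finset.union_comm D C).trans hCu) hCd.symm
        exact ih (insert v D).card (by omega) (insert v D) (B ∪ insert v C) v rfl
          (hu.trans hAB) hi hD1 (hB.union hC1) (by omega)

/-- A cluster of size `3 n` contains two edge-disjoint connected pieces of size `n`. -/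
theorem HasLargeCluster.disjoint_occurrence {S : Finset V} {n : ℕ} (hn : 1 ≤ n)
    {X : Finset (Sym2 V)} (hX : X ⊆ S.sym2) (h : HasLargeCluster S (3 * n) X) :
    ∃ I J, I ⊆ X ∧ J ⊆ X ∧ Disjoint I J ∧ HasLargeCluster S n I ∧ HasLargeCluster S n J := by
  obtain ⟨x, hx, hcard⟩ := h
  have hWS : finCluster X S x ⊆ S := finCluster_subset X S x
  have hxW : x ∈ finCluster X S x := mem_finCluster.2 ⟨hx, Conn.refl _ _⟩
  obtain ⟨A, B, v, hAB, hv, hA, hB, hnA, hnB⟩ := exists_balanced_split X (finCluster X S x) hn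
    hcard _ (finCluster X S x) {x} x rfl
    (Finset.union_eq_left.2 (Finset.singleton_subset_iff.2 hxW))
    (Finset.inter_eq_right.2 (Finset.singleton_subset_iff.2 hxW))
    (connTo_finCluster X hX hx)
    (fun y hy => by rw [Finset.mem_singleton.1 hy]; exact Conn.refl _ _) (by omega)
  have hAS : A ⊆ S := (Finset.subset_union_left.trans hAB.subset).trans hWS
  have hBS : B ⊆ S := (Finset.subset_union_right.trans hAB.subset).trans hWS
  have hvAB : v ∈ A ∩ B := by rw [hv]; exact Finset.mem_singleton_self v
  have hvS : v ∈ S := hAS (Finset.mem_inter.1 hvAB).1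
  -- The only edge that may lie in both parts is the loop at `v`, which no path needs.
  refine ⟨X ∩ A.sym2, (X ∩ B.sym2).erase s(v, v), Finset.inter_subset_left,
    (Finset.erase_subset _ _).trans Finset.inter_subset_left, ?_, ⟨v, hvS, ?_⟩, ⟨v, hvS, ?_⟩⟩
  · rw [Finset.disjoint_left]
    intro e
    induction e using Sym2.ind with
    | _ a b =>
      intro h1 h2
      simp only [Finset.mem_erase, Finset.mem_inter, Finset.mk_mem_sym2_iff] at h1 h2
      have ha : a ∈ A ∩ B := Finset.mem_inter.2 ⟨h1.2.1, h2.2.2.1⟩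
      have hb : b ∈ A ∩ B := Finset.mem_inter.2 ⟨h1.2.2, h2.2.2.2⟩
      rw [hv, Finset.mem_singleton] at ha hb
      exact h2.1 (by rw [ha, hb])
  · exact hnA.trans (Finset.card_le_card fun y hy =>
      mem_finCluster.2 ⟨hAS hy, (hA y hy).symm⟩)
  · exact hnB.trans (Finset.card_le_card fun y hy =>
      mem_finCluster.2 ⟨hBS hy, ((hB y hy).erase_loop v).symm⟩)

theorem prob_hasLargeCluster_three_mul_le {p : Sym2 V → ℝ} (hp : ∀ e, p e ∈ Set.Icc (0 : ℝ) 1)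
    (S : Finset V) {n : ℕ} (hn : 1 ≤ n) :
    prob p S.sym2 (HasLargeCluster S (3 * n)) ≤ prob p S.sym2 (HasLargeCluster S n) ^ 2 := by
  rw [sq]
  exact (prob_mono hp fun X hX h => h.disjoint_occurrence hn hX).trans
    (prob_disjoint_occurrence_le hp _ HasLargeCluster.mono HasLargeCluster.mono)

theorem prob_hasLargeCluster_three_pow_mul_le {p : Sym2 V → ℝ}
    (hp : ∀ e, p e ∈ Set.Icc (0 : ℝ) 1) (S : Finset V) {n : ℕ} (hn : 1 ≤ n) (k : ℕ) :
    prob p S.sym2 (HasLargeCluster S (3 ^ k * n))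
      ≤ prob p S.sym2 (HasLargeCluster S n) ^ 2 ^ k := by
  induction k with
  | zero => simp
  | succ k ih =>
    have h := prob_hasLargeCluster_three_mul_le hp S (n := 3 ^ k * n)
      (Nat.one_le_iff_ne_zero.2 (by positivity))
    rw [pow_succ' 3, mul_assoc, pow_succ 2, pow_mul]
    exact h.trans (pow_le_pow_left₀ (prob_nonneg hp _ _) ih 2)

end Clusters

/-! ### Finiteness of the mean cluster size -/

section MeanSize

variable {V : Type*} [DecidableEq V]

/-- The probability that `x` and `y` are joined by open edges inside the finite set `S`. -/
noncomputable def connProb (p : Sym2 V → ℝ) (S : Finset V) (x y : V) : ℝ :=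
  prob p S.sym2 (fun X => Conn X x y)

/-- The mean size of the cluster of `x` in the percolation restricted to the finite set `S`. -/
noncomputable def meanSize (p : Sym2 V → ℝ) (S : Finset V) (x : V) : ℝ :=
  ∑ y ∈ S, connProb p S x y

theorem connProb_comm (p : Sym2 V → ℝ) (S : Finset V) (x y : V) :
    connProb p S x y = connProb p S y x :=
  prob_congr fun _ _ => Conn.comm

theorem connProb_nonneg {p : Sym2 V → ℝ} (hp : ∀ e, p e ∈ Set.Icc (0 : ℝ) 1) (S : Finset V)
    (x y : V) : 0 ≤ connProb p S x y := prob_nonneg hp _ _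

theorem connProb_mono {p : Sym2 V → ℝ} (hp : ∀ e, p e ∈ Set.Icc (0 : ℝ) 1) {S T : Finset V}
    (h : S ⊆ T) (x y : V) : connProb p S x y ≤ connProb p T x y := by
  rw [connProb, ← prob_inter p (Finset.sym2_mono h)]
  exact prob_mono hp fun X _ hX => hX.mono Finset.inter_subset_left

theorem meanSize_nonneg {p : Sym2 V → ℝ} (hp : ∀ e, p e ∈ Set.Icc (0 : ℝ) 1) (S : Finset V)
    (x : V) : 0 ≤ meanSize p S x := Finset.sum_nonneg fun _ _ => connProb_nonneg hp _ _ _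

theorem meanSize_eq_expect (p : Sym2 V → ℝ) (S : Finset V) (x : V) :
    meanSize p S x = expect p S.sym2 (fun X => ((finCluster X S x).card : ℝ)) := by
  unfold meanSize connProb prob
  rw [← expect_sum]
  exact expect_congr fun X _ => by simp [finCluster]

/-- Consider a path from `v ∈ T` to `y ∉ T`, and let `x` be its last vertex in the cluster of `v`
inside `T`. The next vertex `z` lies outside `T`, and the rest of the path avoids that cluster. -/
theorem Conn.exists_exit {X : Finset (Sym2 V)} {Λ T : Finset V} (hX : X ⊆ Λ.sym2) {v y : V}
    (hvT : v ∈ T) (hy : y ∉ T) (h : Conn X v y) :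
    ∃ x ∈ T, ∃ z ∈ Λ \ T, ∃ I J, I ⊆ X ∧ J ⊆ X ∧ Disjoint I J ∧
      (Conn (I ∩ T.sym2) v x ∧ s(x, z) ∈ I) ∧ Conn J z y := by
  set K := finCluster (X ∩ T.sym2) T v with hK
  have hKT : K ⊆ T := finCluster_subset _ _ _
  have hvK : v ∈ K := mem_finCluster.2 ⟨hvT, Conn.refl _ _⟩
  have hconn : ConnTo (X ∩ T.sym2) K v := connTo_finCluster _ Finset.inter_subset_right hvT
  have claim : ∀ u, Conn X u y → (u ∉ K ∧ Conn (X ∩ (Λ \ K).sym2) u y) ∨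
      ∃ x ∈ K, ∃ z ∈ Λ \ K, s(x, z) ∈ X ∧ Conn (X ∩ (Λ \ K).sym2) z y := by
    intro u hu
    induction hu using Relation.ReflTransGen.head_induction_on with
    | refl => exact Or.inl ⟨fun h => hy (hKT h), Conn.refl _ _⟩
    | @head a c hac _ ih =>
      rcases ih with ⟨hc, hcy⟩ | ih
      · obtain ⟨haΛ, hcΛ⟩ := Finset.mk_mem_sym2_iff.1 (hX hac)
        by_cases ha : a ∈ K
        · exact Or.inr ⟨a, ha, c, Finset.mem_sdiff.2 ⟨hcΛ, hc⟩, hac, hcy⟩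
        · refine Or.inl ⟨ha, (Conn.single (Finset.mem_inter.2 ⟨hac, ?_⟩)).trans hcy⟩
          exact Finset.mk_mem_sym2_iff.2
            ⟨Finset.mem_sdiff.2 ⟨haΛ, ha⟩, Finset.mem_sdiff.2 ⟨hcΛ, hc⟩⟩
      · exact Or.inr ih
  rcases claim v h with ⟨h1, -⟩ | ⟨x, hx, z, hz, hxz, hzy⟩
  · exact absurd hvK h1
  obtain ⟨hzΛ, hzK⟩ := Finset.mem_sdiff.1 hz
  have hzT : z ∉ T := fun hzT => hzK (mem_finCluster.2 ⟨hzT,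
    (mem_finCluster.1 hx).2.trans (Conn.single (Finset.mem_inter.2
      ⟨hxz, Finset.mk_mem_sym2_iff.2 ⟨hKT hx, hzT⟩⟩))⟩)
  refine ⟨x, hKT hx, z, Finset.mem_sdiff.2 ⟨hzΛ, hzT⟩, insert s(x, z) (X ∩ K.sym2),
    X ∩ (Λ \ K).sym2, Finset.insert_subset hxz Finset.inter_subset_left,
    Finset.inter_subset_left, ?_, ⟨?_, Finset.mem_insert_self _ _⟩, hzy⟩
  · rw [Finset.disjoint_left]
    intro e
    induction e using Sym2.ind with
    | _ a b =>
      intro h1 h2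
      obtain ⟨ha, hb⟩ := Finset.mk_mem_sym2_iff.1 (Finset.mem_inter.1 h2).2
      have ha' := (Finset.mem_sdiff.1 ha).2
      have hb' := (Finset.mem_sdiff.1 hb).2
      rcases Finset.mem_insert.1 h1 with h1 | h1
      · rcases Sym2.eq_iff.1 h1 with ⟨rfl, rfl⟩ | ⟨rfl, rfl⟩
        · exact ha' hx
        · exact hb' hx
      · exact ha' (Finset.mk_mem_sym2_iff.1 (Finset.mem_inter.1 h1).2).1
  · refine (hconn x hx).symm.mono fun e he => ?_
    simp only [Finset.mem_inter, Finset.mem_insert] at he ⊢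
    exact ⟨Or.inr ⟨he.1.1, he.2⟩, he.1.2⟩

theorem prob_conn_and_mem_le {p : Sym2 V → ℝ} (hp : ∀ e, p e ∈ Set.Icc (0 : ℝ) 1)
    {Λ T : Finset V} (hT : T ⊆ Λ) {v x z : V} (hx : x ∈ T) (hz : z ∈ Λ \ T) :
    prob p Λ.sym2 (fun X => Conn (X ∩ T.sym2) v x ∧ s(x, z) ∈ X)
      ≤ connProb p T v x * p s(x, z) := by
  obtain ⟨hzΛ, hzT⟩ := Finset.mem_sdiff.1 hz
  have h := prob_disjoint_occurrence_le hp Λ.sym2 (A := fun X => Conn (X ∩ T.sym2) v x)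
    (B := fun X => s(x, z) ∈ X)
    (fun I I' h hc => hc.mono (Finset.inter_subset_inter_right h)) (fun I I' h hm => h hm)
  rw [prob_inter p (Finset.sym2_mono hT) (fun X => Conn X v x),
    prob_mem p (Finset.mk_mem_sym2_iff.2 ⟨hT hx, hzΛ⟩)] at h
  refine (prob_mono hp fun X _ hX => ?_).trans h
  refine ⟨X ∩ T.sym2, {s(x, z)}, Finset.inter_subset_left,
    Finset.singleton_subset_iff.2 hX.2, ?_, ?_, Finset.mem_singleton_self _⟩
  · rw [Finset.disjoint_singleton_right]
    exact fun h => hzT (Finset.mk_mem_sym2_iff.1 (Finset.mem_inter.1 h).2).2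
  · rw [Finset.inter_assoc, Finset.inter_self]
    exact hX.1

/-- The path decomposition of `Conn.exists_exit`, combined with the van den Berg–Kesten
inequality. -/
theorem connProb_le_add_sum {p : Sym2 V → ℝ} (hp : ∀ e, p e ∈ Set.Icc (0 : ℝ) 1)
    {Λ T : Finset V} (hT : T ⊆ Λ) {v : V} (hv : v ∈ T) (y : V) :
    connProb p Λ v y ≤ (if y ∈ T then 1 else 0) +
      ∑ x ∈ T, ∑ z ∈ Λ \ T, connProb p T v x * p s(x, z) * connProb p Λ z y := by
  have hnn : ∀ x z, 0 ≤ connProb p T v x * p s(x, z) * connProb p Λ z y := fun x z =>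
    mul_nonneg (mul_nonneg (connProb_nonneg hp _ _ _) (hp _).1) (connProb_nonneg hp _ _ _)
  split_ifs with hy
  · have := prob_le_one hp Λ.sym2 (fun X => Conn X v y)
    have h2 : 0 ≤ ∑ x ∈ T, ∑ z ∈ Λ \ T, connProb p T v x * p s(x, z) * connProb p Λ z y :=
      Finset.sum_nonneg fun x _ => Finset.sum_nonneg fun z _ => hnn x z
    rw [connProb]
    linarith
  · rw [zero_add]
    refine (prob_mono hp fun X hX h => h.exists_exit hX hv hy).trans ?_
    refine (prob_exists_le hp _ _ _).trans (Finset.sum_le_sum fun x hx => ?_)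
    refine (prob_exists_le hp _ _ _).trans (Finset.sum_le_sum fun z hz => ?_)
    refine (prob_disjoint_occurrence_le hp _
      (A := fun I => Conn (I ∩ T.sym2) v x ∧ s(x, z) ∈ I) (B := fun J => Conn J z y)
      (fun I I' h hc => ⟨hc.1.mono (Finset.inter_subset_inter_right h), h hc.2⟩)
      (fun I I' h hc => hc.mono h)).trans ?_
    exact mul_le_mul_of_nonneg_right (prob_conn_and_mem_le hp hT hx hz)
      (connProb_nonneg hp _ _ _)

theorem meanSize_le_add_sum {p : Sym2 V → ℝ} (hp : ∀ e, p e ∈ Set.Icc (0 : ℝ) 1)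
    {Λ T : Finset V} (hT : T ⊆ Λ) {v : V} (hv : v ∈ T) :
    meanSize p Λ v ≤ T.card +
      ∑ x ∈ T, ∑ z ∈ Λ \ T, connProb p T v x * p s(x, z) * meanSize p Λ z := by
  refine (Finset.sum_le_sum fun y _ => connProb_le_add_sum hp hT hv y).trans (le_of_eq ?_)
  rw [Finset.sum_add_distrib]
  congr 1
  · rw [Finset.sum_ite_mem, Finset.inter_eq_right.2 hT]
    simp
  · rw [Finset.sum_comm]
    refine Finset.sum_congr rfl fun x _ => ?_
    rw [Finset.sum_comm]
    refine Finset.sum_congr rfl fun z _ => ?_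
    rw [meanSize, Finset.mul_sum]

/-- The Duminil-Copin–Tassion criterion: if around every vertex `v` there is a set `T` of bounded
size such that the mean number of open edges leaving `T` from the cluster of `v` inside `T` is at
most `r < 1`, then the mean cluster sizes are bounded uniformly in the volume. -/
theorem meanSize_le_of_exit_le {p : Sym2 V → ℝ} (hp : ∀ e, p e ∈ Set.Icc (0 : ℝ) 1) {r n₀ : ℝ}
    (hr : r < 1)
    (h : ∀ v, ∃ T : Finset V, v ∈ T ∧ (T.card : ℝ) ≤ n₀ ∧ ∀ Z : Finset V, Disjoint T Z →
      ∑ x ∈ T, connProb p T v x * ∑ z ∈ Z, p s(x, z) ≤ r)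
    (Λ : Finset V) {v : V} (hv : v ∈ Λ) : meanSize p Λ v ≤ n₀ / (1 - r) := by
  obtain ⟨w, hw, hmax⟩ := Λ.exists_max_image (meanSize p Λ) ⟨v, hv⟩
  refine (hmax v hv).trans ?_
  obtain ⟨T, hwT, hcard, hexit⟩ := h w
  have hM := meanSize_nonneg hp Λ w
  have h1 := meanSize_le_add_sum hp (Finset.inter_subset_right : T ∩ Λ ⊆ Λ)
    (Finset.mem_inter.2 ⟨hwT, hw⟩)
  have h2 : ∑ x ∈ T ∩ Λ, ∑ z ∈ Λ \ (T ∩ Λ), connProb p (T ∩ Λ) w x * p s(x, z) * meanSize p Λ z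
      ≤ r * meanSize p Λ w := by
    calc _ ≤ ∑ x ∈ T ∩ Λ, ∑ z ∈ Λ \ (T ∩ Λ), connProb p T w x * p s(x, z) * meanSize p Λ w := by
          refine Finset.sum_le_sum fun x _ => Finset.sum_le_sum fun z hz => ?_
          have h3 := hmax z (Finset.mem_sdiff.1 hz).1
          have h4 := connProb_mono hp (Finset.inter_subset_left : T ∩ Λ ⊆ T) w x
          have h5 := (hp s(x, z)).1
          have h6 := connProb_nonneg hp (T ∩ Λ) w x
          have h7 := connProb_nonneg hp T w x
          gcongr
          exact meanSize_nonneg hp Λ z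
      _ = (∑ x ∈ T ∩ Λ, connProb p T w x * ∑ z ∈ Λ \ (T ∩ Λ), p s(x, z)) * meanSize p Λ w := by
          simp only [Finset.mul_sum, Finset.sum_mul]
      _ ≤ (∑ x ∈ T, connProb p T w x * ∑ z ∈ Λ \ (T ∩ Λ), p s(x, z)) * meanSize p Λ w := by
          refine mul_le_mul_of_nonneg_right (Finset.sum_le_sum_of_subset_of_nonneg
            Finset.inter_subset_left fun x _ _ => ?_) hM
          exact mul_nonneg (connProb_nonneg hp _ _ _) (Finset.sum_nonneg fun z _ => (hp _).1)
      _ ≤ r * meanSize p Λ w := by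
          refine mul_le_mul_of_nonneg_right (hexit _ ?_) hM
          rw [Finset.disjoint_left]
          intro a haT ha
          obtain ⟨h1, h2⟩ := Finset.mem_sdiff.1 ha
          exact h2 (Finset.mem_inter.2 ⟨haT, h1⟩)
  have h3 : ((T ∩ Λ).card : ℝ) ≤ n₀ :=
    le_trans (by exact_mod_cast Finset.card_le_card Finset.inter_subset_left) hcard
  rw [le_div_iff₀ (by linarith)]
  nlinarith

end MeanSize

/-! ### Finite volumes and the percolation measure -/

section Embedding

variable {V W : Type*}

theorem conn_map_iff (f : V ↪ W) {X : Finset (Sym2 V)} {x y : V} :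
    Conn (X.map f.sym2Map) (f x) (f y) ↔ Conn X x y := by
  constructor
  · intro h
    have key : ∀ w, Conn (X.map f.sym2Map) (f x) w → ∃ y, w = f y ∧ Conn X x y := by
      intro w hw
      induction hw with
      | refl => exact ⟨x, rfl, Conn.refl _ _⟩
      | @tail b c _ hbc ih =>
        obtain ⟨b, rfl, hb⟩ := ih
        obtain ⟨e, he, h⟩ := Finset.mem_map.1 hbc
        induction e using Sym2.ind with
        | _ u v =>
          rcases Sym2.eq_iff.1 h with ⟨h1, h2⟩ | ⟨h1, h2⟩
          · obtain rfl := f.injective h1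
            exact ⟨v, h2.symm, hb.trans (Conn.single he)⟩
          · obtain rfl := f.injective h2
            exact ⟨u, h1.symm, hb.trans (Conn.single (by rwa [Sym2.eq_swap]))⟩
    obtain ⟨z, hz, h⟩ := key _ h
    rwa [f.injective hz]
  · intro h
    induction h with
    | refl => exact Conn.refl _ _
    | tail _ hbc ih => exact ih.trans (Conn.single (Finset.mem_map.2 ⟨_, hbc, rfl⟩))

theorem finCluster_map (f : V ↪ W) (X : Finset (Sym2 V)) (S : Finset V) (x : V) :
    finCluster (X.map f.sym2Map) (S.map f) (f x) = (finCluster X S x).map f := by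
  ext w
  simp only [mem_finCluster, Finset.mem_map]
  constructor
  · rintro ⟨⟨y, hy, rfl⟩, h⟩
    exact ⟨y, ⟨hy, (conn_map_iff f).1 h⟩, rfl⟩
  · rintro ⟨y, ⟨hy, h⟩, rfl⟩
    exact ⟨⟨y, hy, rfl⟩, (conn_map_iff f).2 h⟩

variable [DecidableEq V] [DecidableEq W]

open Classical in
theorem prob_sym2_map (p : Sym2 W → ℝ) (f : V ↪ W) (S : Finset V) (P : Finset (Sym2 W) → Prop) :
    prob p (S.map f).sym2 P
      = prob (fun e => p (f.sym2Map e)) S.sym2 (fun X => P (X.map f.sym2Map)) := by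
  rw [Finset.sym2_map]
  exact expect_map p f.sym2Map S.sym2 (fun X => if P X then 1 else 0)

theorem connProb_map (p : Sym2 W → ℝ) (f : V ↪ W) (S : Finset V) (x y : V) :
    connProb p (S.map f) (f x) (f y) = connProb (fun e => p (f.sym2Map e)) S x y := by
  rw [connProb, prob_sym2_map]
  exact prob_congr fun X _ => conn_map_iff f

theorem prob_finCluster_map (p : Sym2 W → ℝ) (f : V ↪ W) (S : Finset V) (x : V) (n : ℕ) :
    prob p (S.map f).sym2 (fun X => n ≤ (finCluster X (S.map f) (f x)).card)
      = prob (fun e => p (f.sym2Map e)) S.sym2 (fun X => n ≤ (finCluster X S x).card) := by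
  rw [prob_sym2_map]
  exact prob_congr fun X _ => by rw [finCluster_map, Finset.card_map]

end Embedding

/-- The open edges of `ω` inside `S`. -/
def openEdges {d : ℕ} (ω : Sym2 (Fin d → ℤ) → Bool) (S : Finset (Fin d → ℤ)) :
    Finset (Sym2 (Fin d → ℤ)) :=
  S.sym2.filter (fun e => ω e = true)

theorem openEdges_mono {d : ℕ} (ω : Sym2 (Fin d → ℤ) → Bool) {S T : Finset (Fin d → ℤ)}
    (h : S ⊆ T) : openEdges ω S ⊆ openEdges ω T :=
  Finset.filter_subset_filter _ (Finset.sym2_mono h)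

theorem finCluster_openEdges_mono {d : ℕ} (ω : Sym2 (Fin d → ℤ) → Bool)
    {S T : Finset (Fin d → ℤ)} (h : S ⊆ T) (x : Fin d → ℤ) :
    finCluster (openEdges ω S) S x ⊆ finCluster (openEdges ω T) T x := fun _ hy =>
  mem_finCluster.2 ⟨h (mem_finCluster.1 hy).1, (mem_finCluster.1 hy).2.mono (openEdges_mono ω h)⟩

theorem mem_cluster_of_conn {d : ℕ} {ω : Sym2 (Fin d → ℤ) → Bool} {S : Finset (Fin d → ℤ)}
    {x y : Fin d → ℤ} (h : Conn (openEdges ω S) x y) : y ∈ cluster ω x := by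
  change (openGraph ω).Reachable x y
  induction h with
  | refl => exact SimpleGraph.Reachable.refl _
  | @tail b c _ hbc ih =>
    -- Loops are not edges of `openGraph`, but they do not move the path either.
    by_cases hb : b = c
    · exact hb ▸ ih
    · refine ih.trans (SimpleGraph.Adj.reachable ?_)
      exact ⟨hb, (Finset.mem_filter.1 hbc).2⟩

/-- The box `{-m, …, m}^d`. -/
noncomputable def centeredBox (d m : ℕ) : Finset (Fin d → ℤ) :=
  Finset.Icc (fun _ => -(m : ℤ)) (fun _ => (m : ℤ))

theorem centeredBox_mono (d : ℕ) : Monotone (centeredBox d) := fun m m' h =>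
  Finset.Icc_subset_Icc (fun _ => by simpa using h) (fun _ => by simpa using h)

theorem zero_mem_centeredBox (d m : ℕ) : (0 : Fin d → ℤ) ∈ centeredBox d m :=
  Finset.mem_Icc.2 ⟨fun _ => by simp, fun _ => by simp⟩

theorem eventually_mem_centeredBox {d : ℕ} (x : Fin d → ℤ) :
    ∀ᶠ m in atTop, x ∈ centeredBox d m := by
  filter_upwards [eventually_ge_atTop (∑ i, (x i).natAbs)] with m hm
  have h : ∀ i, (x i).natAbs ≤ m := fun i =>
    (Finset.single_le_sum (f := fun i => (x i).natAbs) (fun _ _ => Nat.zero_le _)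
      (Finset.mem_univ i)).trans hm
  refine Finset.mem_Icc.2 ⟨fun i => ?_, fun i => ?_⟩
  · have := h i
    change -(m : ℤ) ≤ x i
    omega
  · have := h i
    change x i ≤ (m : ℤ)
    omega

theorem eventually_mem_finCluster {d : ℕ} {ω : Sym2 (Fin d → ℤ) → Bool} {x y : Fin d → ℤ}
    (h : y ∈ cluster ω x) :
    ∀ᶠ m in atTop, y ∈ finCluster (openEdges ω (centeredBox d m)) (centeredBox d m) x := by
  have h' := (SimpleGraph.reachable_iff_reflTransGen x y).1 h
  clear h
  induction h' with
  | refl =>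
    filter_upwards [eventually_mem_centeredBox x] with m hm
    exact mem_finCluster.2 ⟨hm, Conn.refl _ _⟩
  | @tail b c _ hbc ih =>
    filter_upwards [ih, eventually_mem_centeredBox c] with m hm hc
    obtain ⟨hb, hxb⟩ := mem_finCluster.1 hm
    exact mem_finCluster.2 ⟨hc, hxb.trans (Conn.single (Finset.mem_filter.2
      ⟨Finset.mk_mem_sym2_iff.2 ⟨hb, hc⟩, hbc.2⟩))⟩

namespace PercolationKernel

variable {d : ℕ} (K : PercolationKernel d)

/-- The probability that the edge `e` is open, as a real number. -/
noncomputable def edgeWeight (β : ℝ≥0) (e : Sym2 (Fin d → ℤ)) : ℝ := K.edgeProb β e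

theorem edgeWeight_mk (β : ℝ≥0) (x y : Fin d → ℤ) :
    K.edgeWeight β s(x, y) = 1 - Real.exp (-((β : ℝ) * (K.J x y : ℝ))) := rfl

theorem edgeWeight_mem (β : ℝ≥0) (e : Sym2 (Fin d → ℤ)) : K.edgeWeight β e ∈ Set.Icc (0 : ℝ) 1 :=
  (K.edgeProb β e).2

theorem edgeWeight_le (β : ℝ≥0) (x y : Fin d → ℤ) :
    K.edgeWeight β s(x, y) ≤ β * K.J x y := by
  rw [edgeWeight_mk]
  linarith [Real.add_one_le_exp (-((β : ℝ) * (K.J x y : ℝ)))]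

theorem J_add_right (x y t : Fin d → ℤ) : K.J (x + t) (y + t) = K.J x y := by
  rw [K.transl, K.transl x y, add_sub_add_right_eq_sub]

theorem edgeWeight_translate (β : ℝ≥0) (t : Fin d → ℤ) :
    (fun e => K.edgeWeight β ((addRightEmbedding t).sym2Map e)) = K.edgeWeight β := by
  funext e
  induction e using Sym2.ind with
  | _ x y =>
    change K.edgeWeight β s(x + t, y + t) = _
    rw [edgeWeight_mk, edgeWeight_mk, J_add_right]

instance isProbabilityMeasure_law (β : ℝ≥0) : IsProbabilityMeasure (K.law β) := by
  unfold law
  infer_instance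

theorem law_real_filter_eq (β : ℝ≥0) (F : Finset (Sym2 (Fin d → ℤ)))
    {X : Finset (Sym2 (Fin d → ℤ))} (hX : X ⊆ F) :
    (K.law β).real {ω | F.filter (fun e => ω e = true) = X}
      = (∏ e ∈ X, K.edgeWeight β e) * ∏ e ∈ F \ X, (1 - K.edgeWeight β e) := by
  have hset : {ω : Sym2 (Fin d → ℤ) → Bool | F.filter (fun e => ω e = true) = X}
      = (F : Set (Sym2 (Fin d → ℤ))).pi (fun e => {decide (e ∈ X)}) := by
    ext ω
    simp only [Set.mem_ofPred_eq, Finset.ext_iff, Finset.mem_filter, Set.mem_pi, Finset.mem_coe,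
      Set.mem_singleton_iff]
    refine ⟨fun h e he => ?_, fun h e => ?_⟩
    · have := h e
      by_cases heX : e ∈ X <;> simp_all
    · by_cases he : e ∈ F
      · simp [he, h e he]
      · simp only [he, false_and, false_iff]
        exact fun h => he (hX h)
  rw [hset, measureReal_def, law, Measure.infinitePi_pi _ (fun e _ => measurableSet_singleton _),
    ENNReal.toReal_prod, ← Finset.prod_sdiff hX, mul_comm]
  congr 1 <;> refine Finset.prod_congr rfl fun e he => ?_
  · rw [← measureReal_def, ProbabilityTheory.bernoulliMeasure_real_apply_of_mem_of_notMem]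
    all_goals simp [he, edgeWeight]
  · rw [← measureReal_def, ProbabilityTheory.bernoulliMeasure_real_apply_of_notMem_of_mem]
    all_goals simp [(Finset.mem_sdiff.1 he).2, edgeWeight]

theorem measurableSet_filter_eq (F X : Finset (Sym2 (Fin d → ℤ))) :
    MeasurableSet {ω : Sym2 (Fin d → ℤ) → Bool | F.filter (fun e => ω e = true) = X} := by
  have h : {ω : Sym2 (Fin d → ℤ) → Bool | F.filter (fun e => ω e = true) = X}
      = ⋂ e, {ω | (e ∈ F ∧ ω e = true) ↔ e ∈ X} := by
    ext ω
    simp [Finset.ext_iff]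
  rw [h]
  refine MeasurableSet.iInter fun e => ?_
  exact (MeasurableSet.of_discrete (s := {b : Bool | (e ∈ F ∧ b = true) ↔ e ∈ X})).preimage
    (measurable_pi_apply e)

/-- The law of the open edges inside a finite set. -/
theorem law_real_openEdges (β : ℝ≥0) (S : Finset (Fin d → ℤ))
    (P : Finset (Sym2 (Fin d → ℤ)) → Prop) :
    (K.law β).real {ω | P (openEdges ω S)} = prob (K.edgeWeight β) S.sym2 P := by
  classical
  have hset : {ω : Sym2 (Fin d → ℤ) → Bool | P (openEdges ω S)}
      = ⋃ X ∈ S.sym2.powerset.filter P,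
        {ω | S.sym2.filter (fun e => ω e = true) = X} := by
    ext ω
    simp only [Set.mem_ofPred_eq, Set.mem_iUnion, Finset.mem_filter, Finset.mem_powerset,
      exists_prop, exists_eq_right', Finset.filter_subset, true_and]
    rfl
  rw [hset, measureReal_biUnion_finset ?_ (fun X _ => measurableSet_filter_eq _ X), prob, expect,
    Finset.sum_filter]
  · refine Finset.sum_congr rfl fun X hX => ?_
    by_cases h : P X
    · simp [h, K.law_real_filter_eq β S.sym2 (Finset.mem_powerset.1 hX)]
    · simp [h]
  · intro X _ Y _ hXY
    exact Set.disjoint_left.2 fun ω h1 h2 => hXY (h1.symm.trans h2)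

/-- The tail of the cluster size in a finite volume is dominated by that in infinite volume. -/
theorem prob_card_finCluster_le (β : ℝ≥0) (S : Finset (Fin d → ℤ)) (x : Fin d → ℤ) (n : ℕ) :
    prob (K.edgeWeight β) S.sym2 (fun X => n ≤ (finCluster X S x).card)
      ≤ K.clusterTail β n := by
  have h := prob_finCluster_map (K.edgeWeight β) (addRightEmbedding (-x)) S x n
  rw [K.edgeWeight_translate] at h
  rw [← h, ← K.law_real_openEdges, clusterTail]
  refine measureReal_mono fun ω hω => ?_
  have h0 : (addRightEmbedding (-x)) x = 0 := by simp [addRightEmbedding]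
  simp only [h0, Set.mem_ofPred_eq] at hω ⊢
  refine le_trans ?_ (Set.encard_le_encard (s := (finCluster
    (openEdges ω (S.map (addRightEmbedding (-x)))) (S.map (addRightEmbedding (-x))) 0 :
      Finset (Fin d → ℤ))) fun y hy => mem_cluster_of_conn (mem_finCluster.1 hy).2)
  rw [Set.encard_coe_eq_coe_finsetCard]
  exact_mod_cast hω

/-- If the mean cluster sizes in finite volumes are bounded, there is no infinite cluster. -/
theorem law_infinite_eq_zero (β : ℝ≥0) {C : ℝ}
    (hC : ∀ m, meanSize (K.edgeWeight β) (centeredBox d m) 0 ≤ C) :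
    K.law β {ω | (cluster ω 0).Infinite} = 0 := by
  have hbound : ∀ n : ℕ,
      K.law β {ω | (cluster ω 0).Infinite} ≤ ENNReal.ofReal (C / (n + 1 : ℕ)) := by
    intro n
    set E : ℕ → Set (Sym2 (Fin d → ℤ) → Bool) := fun m =>
      {ω | n + 1 ≤ (finCluster (openEdges ω (centeredBox d m)) (centeredBox d m) 0).card} with hE
    have hmono : Monotone E := fun m m' hm ω hω => le_trans hω (Finset.card_le_card
      (finCluster_openEdges_mono ω (centeredBox_mono d hm) 0))
    have hsub : {ω | (cluster ω 0).Infinite} ⊆ ⋃ m, E m := by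
      intro ω hω
      obtain ⟨t, ht, htn⟩ := Set.Infinite.exists_subset_card_eq hω (n + 1)
      have hev : ∀ᶠ m in atTop, ∀ y ∈ t,
          y ∈ finCluster (openEdges ω (centeredBox d m)) (centeredBox d m) 0 :=
        (Filter.eventually_all_finset t).2 fun y hy => eventually_mem_finCluster (ht hy)
      obtain ⟨m, hm⟩ := hev.exists
      exact Set.mem_iUnion.2 ⟨m, htn.ge.trans (Finset.card_le_card hm)⟩
    refine (measure_mono hsub).trans ?_
    rw [hmono.measure_iUnion]
    refine iSup_le fun m => ?_
    rw [← ofReal_measureReal]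
    refine ENNReal.ofReal_le_ofReal ?_
    rw [hE, K.law_real_openEdges β (centeredBox d m)
      (fun X => n + 1 ≤ (finCluster X (centeredBox d m) 0).card), le_div_iff₀ (by positivity)]
    refine le_trans ?_ (hC m)
    rw [meanSize_eq_expect, mul_comm, prob, ← expect_const_mul]
    refine expect_mono (K.edgeWeight_mem β) fun X _ => ?_
    split_ifs with h
    · rw [mul_one]
      exact_mod_cast h
    · rw [mul_zero]
      positivity
  have hlim : Tendsto (fun n : ℕ => ENNReal.ofReal (C / (n + 1 : ℕ))) atTop (𝓝 0) := by
    rw [← ENNReal.ofReal_zero]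
    exact (ENNReal.continuous_ofReal.tendsto 0).comp
      ((tendsto_const_div_atTop_nhds_zero_nat C).comp (tendsto_add_atTop_nat 1))
  exact le_antisymm (ge_of_tendsto' hlim hbound) bot_le

/-! ### The lower bound on exit sums at the critical parameter -/

/-- The total weight `∑_{z ∉ S} J(x,z)` of the edges from `x` to the complement of `S`. -/
noncomputable def exitWeight (S : Finset (Fin d → ℤ)) (x : Fin d → ℤ) : ℝ :=
  ∑' z, if z ∈ S then 0 else (K.J x z : ℝ)

theorem summable_J (x : Fin d → ℤ) : Summable fun z => (K.J x z : ℝ) := by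
  have h : Summable fun z => (K.J 0 z : ℝ) := NNReal.summable_coe.2 K.summable
  have h2 := (Equiv.subRight x).summable_iff.2 h
  refine h2.congr fun z => ?_
  change (K.J 0 (z - x) : ℝ) = K.J x z
  rw [← K.transl]

theorem summable_exitWeight (S : Finset (Fin d → ℤ)) (x : Fin d → ℤ) :
    Summable fun z => if z ∈ S then 0 else (K.J x z : ℝ) :=
  (K.summable_J x).of_nonneg_of_le (fun z => by split_ifs <;> simp)
    (fun z => by split_ifs <;> simp)

theorem exitWeight_nonneg (S : Finset (Fin d → ℤ)) (x : Fin d → ℤ) : 0 ≤ K.exitWeight S x :=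
  tsum_nonneg fun z => by split_ifs <;> simp

theorem sum_J_le_exitWeight {S Z : Finset (Fin d → ℤ)} (h : Disjoint S Z) (x : Fin d → ℤ) :
    ∑ z ∈ Z, (K.J x z : ℝ) ≤ K.exitWeight S x := by
  refine le_trans (le_of_eq ?_) ((K.summable_exitWeight S x).sum_le_tsum Z
    (fun z _ => by split_ifs <;> simp))
  exact Finset.sum_congr rfl fun z hz => by rw [if_neg (Finset.disjoint_right.1 h hz)]

theorem exitWeight_translate (S : Finset (Fin d → ℤ)) (x t : Fin d → ℤ) :
    K.exitWeight (S.map (addRightEmbedding t)) (x + t) = K.exitWeight S x := by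
  unfold exitWeight
  rw [← (Equiv.addRight t).tsum_eq]
  refine tsum_congr fun z => ?_
  simp only [Equiv.coe_addRight, J_add_right]
  refine if_congr ?_ rfl rfl
  simp

/-- The mean number of open edges, counted with the linearized weights `β J`, that leave `S` from
the cluster of `o` inside `S`. -/
noncomputable def exitSum (β : ℝ≥0) (S : Finset (Fin d → ℤ)) (o : Fin d → ℤ) : ℝ :=
  ∑ x ∈ S, connProb (K.edgeWeight β) S o x * (β * K.exitWeight S x)

theorem continuous_exitSum (S : Finset (Fin d → ℤ)) (o : Fin d → ℤ) :
    Continuous fun β => K.exitSum β S o := by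
  have hw : ∀ e, Continuous fun β => K.edgeWeight β e := by
    intro e
    induction e using Sym2.ind with
    | _ x y =>
      simp only [edgeWeight_mk]
      fun_prop
  unfold exitSum connProb prob expect
  fun_prop

theorem law_infinite_eq_zero_of_exitSum_lt_one {β : ℝ≥0} {S : Finset (Fin d → ℤ)}
    {o : Fin d → ℤ} (ho : o ∈ S) (h : K.exitSum β S o < 1) :
    K.law β {ω | (cluster ω 0).Infinite} = 0 := by
  refine K.law_infinite_eq_zero β (C := S.card / (1 - K.exitSum β S o)) fun m => ?_
  refine meanSize_le_of_exit_le (K.edgeWeight_mem β) h (fun v => ?_) _ (zero_mem_centeredBox d m)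
  set t := v - o with ht
  have hot : addRightEmbedding t o = v := by simp [ht]
  refine ⟨S.map (addRightEmbedding t), ?_, by rw [Finset.card_map], fun Z hZ => ?_⟩
  · rw [← hot]
    exact Finset.mem_map_of_mem _ ho
  · rw [Finset.sum_map]
    refine Finset.sum_le_sum fun x hx => ?_
    rw [← hot, connProb_map, K.edgeWeight_translate]
    refine mul_le_mul_of_nonneg_left ?_ (connProb_nonneg (K.edgeWeight_mem β) _ _ _)
    rw [← K.exitWeight_translate S x t]
    calc ∑ z ∈ Z, K.edgeWeight β s(x + t, z) ≤ ∑ z ∈ Z, (β : ℝ) * K.J (x + t) z :=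
          Finset.sum_le_sum fun z _ => K.edgeWeight_le β _ _
      _ = β * ∑ z ∈ Z, (K.J (x + t) z : ℝ) := by rw [Finset.mul_sum]
      _ ≤ _ := mul_le_mul_of_nonneg_left (K.sum_J_le_exitWeight hZ _) β.2

/-- At criticality all exit sums are at least one: otherwise, by continuity, there would be no
infinite cluster at slightly larger parameters either. -/
theorem one_le_exitSum {βc : ℝ≥0} (hβc : K.criticalParameter = (βc : ℝ≥0∞))
    {S : Finset (Fin d → ℤ)} {o : Fin d → ℤ} (ho : o ∈ S) : 1 ≤ K.exitSum βc S o := by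
  by_contra! hlt
  have hev : ∀ᶠ β in 𝓝 βc, K.exitSum β S o < 1 :=
    (K.continuous_exitSum S o).continuousAt.eventually_lt continuousAt_const hlt
  obtain ⟨b, hb, hb'⟩ := (mem_nhdsGE_iff_exists_Ico_subset' (a := βc) (lt_add_one βc)).1
    (mem_nhdsWithin_of_mem_nhds hev)
  have hge : (b : ℝ≥0∞) ≤ K.criticalParameter := by
    refine le_iInf₂ fun β hβ => ?_
    by_contra! hβb
    have h1 : (βc : ℝ≥0∞) ≤ β := hβc ▸ iInf₂_le β hβ
    have h2 := hb' ⟨ENNReal.coe_le_coe.1 h1, ENNReal.coe_lt_coe.1 hβb⟩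
    exact hβ.ne' (K.law_infinite_eq_zero_of_exitSum_lt_one ho h2)
  rw [hβc, ENNReal.coe_le_coe] at hge
  exact absurd hb (not_lt.2 hge)

end PercolationKernel

/-! ### The edge boundary of a box -/

theorem summable_norm_rpow_int {d : ℕ} {r : ℝ} (hr : r < -(d : ℝ)) :
    Summable fun k : Fin d → ℤ => ‖k‖ ^ r := by
  classical
  let b := Pi.basisFun ℝ (Fin d)
  let L := Submodule.span ℤ (Set.range b)
  let bL : Module.Basis (Fin d) ℤ L := b.restrictScalars ℤ
  have hfin : Module.finrank ℤ L = d := by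
    rw [Module.finrank_eq_card_basis bL, Fintype.card_fin]
  have h := ZLattice.summable_norm_rpow L r (by rw [hfin]; exact hr)
  refine (bL.equivFun.symm.toEquiv.summable_iff.2 h).congr fun k => ?_
  have hb : ∀ j, ((bL j : L) : Fin d → ℝ) = Pi.single j 1 := fun j => by
    rw [Module.Basis.restrictScalars_apply, Pi.basisFun_apply]
  have hk : ((bL.equivFun.symm k : L) : Fin d → ℝ) = fun i => (k i : ℝ) := by
    funext i
    simp [Module.Basis.equivFun_symm_apply, Finset.sum_apply, hb, Pi.single_apply]
  have hnorm : ‖((bL.equivFun.symm k : L) : Fin d → ℝ)‖ = ‖k‖ := by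
    rw [hk, Pi.norm_def, Pi.norm_def]
    congr 2
  change ‖((bL.equivFun.symm k : L) : Fin d → ℝ)‖ ^ r = ‖k‖ ^ r
  rw [hnorm]

theorem norm_le_euclNorm {d : ℕ} (k : Fin d → ℤ) : ‖k‖ ≤ euclNorm k := by
  refine (pi_norm_le_iff_of_nonneg (norm_nonneg _)).2 fun i => ?_
  have := PiLp.norm_apply_le (WithLp.toLp 2 (fun i => (k i : ℝ)) : EuclideanSpace ℝ (Fin d)) i
  simpa [euclNorm, Int.norm_eq_abs] using this

theorem le_rpow_of_le_one_of_le_self {t u s : ℝ} (hs0 : 0 < s) (hs1 : s ≤ 1) (ht : 0 ≤ t)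
    (h1 : u ≤ 1) (h2 : u ≤ t) : u ≤ t ^ s := by
  rcases le_total t 1 with h | h
  · rcases ht.eq_or_lt with rfl | ht'
    · rwa [Real.zero_rpow hs0.ne']
    · refine h2.trans ?_
      simpa using Real.rpow_le_rpow_of_exponent_ge ht' h hs1
  · exact h1.trans (Real.one_le_rpow h hs0.le)

/-- The box `{0, …, N-1}^d`. -/
noncomputable def box (d N : ℕ) : Finset (Fin d → ℤ) :=
  Fintype.piFinset fun _ => Finset.Ico (0 : ℤ) N

theorem card_box (d N : ℕ) : (box d N).card = N ^ d := by
  simp [box]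

theorem mem_box {d N : ℕ} {x : Fin d → ℤ} : x ∈ box d N ↔ ∀ i, x i ∈ Finset.Ico (0 : ℤ) N :=
  Fintype.mem_piFinset

theorem card_Ico_filter_shift_le (N : ℕ) (k : ℤ) :
    ((Finset.Ico (0 : ℤ) N).filter fun a => a + k ∉ Finset.Ico (0 : ℤ) N).card ≤ k.natAbs := by
  rcases le_total 0 k with hk | hk
  · refine (Finset.card_le_card (t := Finset.Ico ((N : ℤ) - k) N) fun a ha => ?_).trans ?_
    · simp only [Finset.mem_filter, Finset.mem_Ico] at ha ⊢
      omega
    · simp only [Int.card_Ico]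
      omega
  · refine (Finset.card_le_card (t := Finset.Ico (0 : ℤ) (-k)) fun a ha => ?_).trans ?_
    · simp only [Finset.mem_filter, Finset.mem_Ico] at ha ⊢
      omega
    · simp only [Int.card_Ico]
      omega

/-- The number of points of the box that leave it through the two faces orthogonal to the `i`-th
axis when they are shifted by `k`. -/
theorem card_box_filter_coord_le {d N : ℕ} (hN : 1 ≤ N) {s : ℝ} (hs0 : 0 < s) (hs1 : s ≤ 1)
    (k : Fin d → ℤ) (i : Fin d) :
    (((box d N).filter fun x => x i + k i ∉ Finset.Ico (0 : ℤ) N).card : ℝ)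
      ≤ (N : ℝ) ^ d * (‖k‖ / N) ^ s := by
  set A := (Finset.Ico (0 : ℤ) N).filter fun a => a + k i ∉ Finset.Ico (0 : ℤ) N with hA
  have hNpos : (0 : ℝ) < N := by exact_mod_cast hN
  have hset : ((box d N).filter fun x => x i + k i ∉ Finset.Ico (0 : ℤ) N)
      = Fintype.piFinset (Function.update (fun _ => Finset.Ico (0 : ℤ) N) i A) := by
    ext x
    simp only [Finset.mem_filter, mem_box, Fintype.mem_piFinset]
    constructor
    · rintro ⟨h1, h2⟩ j
      by_cases hj : j = i
      · subst hj
        simpa [hA] using ⟨by simpa using h1 j, by simpa using h2⟩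
      · simpa [hj] using h1 j
    · intro h
      have hi := h i
      simp only [Function.update_self, hA, Finset.mem_filter] at hi
      refine ⟨fun j => ?_, hi.2⟩
      by_cases hj : j = i
      · subst hj; exact hi.1
      · simpa [hj] using h j
  have hcard : ((box d N).filter fun x => x i + k i ∉ Finset.Ico (0 : ℤ) N).card * N
      = A.card * N ^ d := by
    rw [hset, Fintype.card_piFinset]
    have h1 : ∀ j, (Function.update (fun _ : Fin d => Finset.Ico (0 : ℤ) N) i A j).card
        = Function.update (fun _ : Fin d => N) i A.card j := by
      intro j
      by_cases hj : j = i
      · subst hj; simp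
      · simp [hj]
    simp only [h1]
    rw [Finset.prod_update_of_mem (Finset.mem_univ i), mul_assoc]
    congr 1
    rw [Finset.prod_const, ← pow_succ, Finset.card_sdiff_of_subset (Finset.subset_univ _),
      Finset.card_singleton, Finset.card_univ, Fintype.card_fin, Nat.sub_add_cancel i.pos]
  have hcard' : (((box d N).filter fun x => x i + k i ∉ Finset.Ico (0 : ℤ) N).card : ℝ)
      = (N : ℝ) ^ d * (A.card / N) := by
    rw [mul_div_assoc', eq_div_iff hNpos.ne', mul_comm _ (A.card : ℝ)]
    exact_mod_cast hcard
  rw [hcard']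
  refine mul_le_mul_of_nonneg_left ?_ (by positivity)
  refine le_rpow_of_le_one_of_le_self hs0 hs1 (by positivity) ?_ ?_
  · rw [div_le_one hNpos]
    have : A.card ≤ N := (Finset.card_filter_le _ _).trans (by simp)
    exact_mod_cast this
  · gcongr
    have h1 : A.card ≤ (k i).natAbs := card_Ico_filter_shift_le N (k i)
    have h2 : ‖k i‖ ≤ ‖k‖ := norm_le_pi_norm k i
    rw [Int.norm_eq_abs] at h2
    refine le_trans ?_ h2
    rw [← Int.cast_abs, Int.abs_eq_natAbs]
    exact_mod_cast h1

/-- The number of points that leave the box when they are shifted by `k` is at most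
`d N^d min(1, ‖k‖ / N)`, hence at most `d N^d (‖k‖ / N)^s` for every `s ∈ (0, 1]`. -/
theorem card_box_filter_shift_le {d N : ℕ} (hN : 1 ≤ N) {s : ℝ} (hs0 : 0 < s) (hs1 : s ≤ 1)
    (k : Fin d → ℤ) :
    (((box d N).filter fun x => x + k ∉ box d N).card : ℝ)
      ≤ d * ((N : ℝ) ^ d * (‖k‖ / N) ^ s) := by
  have hsub : ((box d N).filter fun x => x + k ∉ box d N) ⊆ Finset.univ.biUnion fun i =>
      (box d N).filter fun x => x i + k i ∉ Finset.Ico (0 : ℤ) N := by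
    intro x hx
    obtain ⟨hx1, hx2⟩ := Finset.mem_filter.1 hx
    rw [mem_box, not_forall] at hx2
    obtain ⟨i, hi⟩ := hx2
    exact Finset.mem_biUnion.2 ⟨i, Finset.mem_univ i, Finset.mem_filter.2 ⟨hx1, hi⟩⟩
  have h1 := (Finset.card_le_card hsub).trans Finset.card_biUnion_le
  calc (((box d N).filter fun x => x + k ∉ box d N).card : ℝ)
      ≤ ∑ i : Fin d, (((box d N).filter fun x => x i + k i ∉ Finset.Ico (0 : ℤ) N).card : ℝ) := by
        exact_mod_cast h1
    _ ≤ ∑ _i : Fin d, (N : ℝ) ^ d * (‖k‖ / N) ^ s :=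
        Finset.sum_le_sum fun i _ => card_box_filter_coord_le hN hs0 hs1 k i
    _ = _ := by simp

namespace PercolationKernel

variable {d : ℕ} (K : PercolationKernel d)

theorem summable_J_mul_norm_rpow {α s C₁ : ℝ} (hs0 : 0 < s) (hsα : s < α)
    (hJ : ∀ x y : Fin d → ℤ, x ≠ y →
      (K.J x y : ℝ) ≤ C₁ * euclNorm (x - y) ^ (-(d : ℝ) - α)) :
    Summable fun k : Fin d → ℤ => (K.J 0 k : ℝ) * ‖k‖ ^ s := by
  have h := (summable_norm_rpow_int (d := d) (r := -(d : ℝ) - α + s) (by linarith)).mul_left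
    (max C₁ 0)
  refine h.of_nonneg_of_le (fun k => by positivity) fun k => ?_
  by_cases hk : k = 0
  · subst hk
    rw [norm_zero, Real.zero_rpow hs0.ne', mul_zero]
    positivity
  · have hk0 : 0 < ‖k‖ := norm_pos_iff.2 hk
    have he : ‖k‖ ≤ euclNorm k := norm_le_euclNorm k
    have h1 : (K.J 0 k : ℝ) ≤ max C₁ 0 * ‖k‖ ^ (-(d : ℝ) - α) := by
      rw [K.symm]
      have h2 := hJ k 0 hk
      rw [sub_zero] at h2
      refine h2.trans (mul_le_mul (le_max_left _ _) ?_ (Real.rpow_nonneg (hk0.le.trans he) _)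
        (le_max_right _ _))
      exact Real.rpow_le_rpow_of_nonpos hk0 he (by
        have : (0 : ℝ) ≤ d := Nat.cast_nonneg d
        linarith)
    rw [Real.rpow_add hk0, ← mul_assoc]
    exact mul_le_mul_of_nonneg_right h1 (by positivity)

/-- The total weight of the edge boundary of a box of side `N` is of order at most `N^{d-s}`. -/
theorem exists_sum_exitWeight_box_le {α s C₁ : ℝ} (hs0 : 0 < s) (hs1 : s ≤ 1) (hsα : s < α)
    (hJ : ∀ x y : Fin d → ℤ, x ≠ y →
      (K.J x y : ℝ) ≤ C₁ * euclNorm (x - y) ^ (-(d : ℝ) - α)) :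
    ∃ C : ℝ, 0 ≤ C ∧ ∀ N : ℕ, 1 ≤ N →
      ∑ x ∈ box d N, K.exitWeight (box d N) x ≤ C * ((N : ℝ) ^ d / (N : ℝ) ^ s) := by
  have hsum := K.summable_J_mul_norm_rpow hs0 hsα hJ
  refine ⟨d * ∑' k : Fin d → ℤ, (K.J 0 k : ℝ) * ‖k‖ ^ s,
    mul_nonneg (Nat.cast_nonneg d) (tsum_nonneg fun k => by positivity), fun N hN => ?_⟩
  have hsh : ∀ x k : Fin d → ℤ, K.J x (x + k) = K.J 0 k := fun x k => by
    rw [K.transl, add_sub_cancel_left]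
  have hexit : ∀ x, K.exitWeight (box d N) x
      = ∑' k, if x + k ∈ box d N then 0 else (K.J 0 k : ℝ) := by
    intro x
    unfold exitWeight
    rw [← (Equiv.addLeft x).tsum_eq]
    simp only [Equiv.coe_addLeft, hsh]
  have hsumm : ∀ x, Summable fun k => if x + k ∈ box d N then 0 else (K.J 0 k : ℝ) := fun x =>
    (K.summable_J 0).of_nonneg_of_le (fun k => by split_ifs <;> simp)
      (fun k => by split_ifs <;> simp)
  simp only [hexit]
  rw [← Summable.tsum_finsetSum fun x _ => hsumm x, mul_assoc, ← tsum_mul_right, ← tsum_mul_left]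
  refine Summable.tsum_le_tsum (fun k => ?_) (summable_sum fun x _ => hsumm x)
    ((hsum.mul_right _).mul_left _)
  have h1 : ∑ x ∈ box d N, (if x + k ∈ box d N then 0 else (K.J 0 k : ℝ))
      = ((box d N).filter fun x => x + k ∉ box d N).card * K.J 0 k := by
    rw [← nsmul_eq_mul, ← Finset.sum_const, Finset.sum_filter]
    exact Finset.sum_congr rfl fun x _ => by split_ifs <;> simp_all
  rw [h1]
  refine (mul_le_mul_of_nonneg_right (card_box_filter_shift_le hN hs0 hs1 k)
    (NNReal.coe_nonneg _)).trans (le_of_eq ?_)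
  rw [Real.div_rpow (norm_nonneg _) (Nat.cast_nonneg _)]
  ring

/-- At criticality, a bound `M` on the mean cluster sizes inside the box of side `N` must be at
least of order `N^s`. -/
theorem rpow_le_of_meanSize_box_le {βc : ℝ≥0} (hβc : K.criticalParameter = (βc : ℝ≥0∞))
    {C s M : ℝ} {N : ℕ} (hN : 1 ≤ N)
    (hC : ∑ x ∈ box d N, K.exitWeight (box d N) x ≤ C * ((N : ℝ) ^ d / (N : ℝ) ^ s))
    (hM : ∀ x ∈ box d N, meanSize (K.edgeWeight βc) (box d N) x ≤ M) (hM0 : 0 ≤ M) :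
    (N : ℝ) ^ s ≤ βc * C * M := by
  have hNpos : (0 : ℝ) < N := by exact_mod_cast hN
  have h1 : ((N : ℝ) ^ d) ≤ ∑ o ∈ box d N, K.exitSum βc (box d N) o := by
    calc ((N : ℝ) ^ d) = ∑ o ∈ box d N, (1 : ℝ) := by
          rw [Finset.sum_const, card_box]
          simp
      _ ≤ _ := Finset.sum_le_sum fun o ho => K.one_le_exitSum hβc ho
  have h2 : ∑ o ∈ box d N, K.exitSum βc (box d N) o
      = ∑ x ∈ box d N, meanSize (K.edgeWeight βc) (box d N) x
          * (βc * K.exitWeight (box d N) x) := by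
    unfold exitSum meanSize
    rw [Finset.sum_comm]
    refine Finset.sum_congr rfl fun x _ => ?_
    rw [Finset.sum_mul]
    exact Finset.sum_congr rfl fun o _ => by rw [connProb_comm]
  have h3 : ∑ x ∈ box d N, meanSize (K.edgeWeight βc) (box d N) x
          * (βc * K.exitWeight (box d N) x)
      ≤ M * (βc * (C * ((N : ℝ) ^ d / (N : ℝ) ^ s))) := by
    calc _ ≤ ∑ x ∈ box d N, M * (βc * K.exitWeight (box d N) x) :=
          Finset.sum_le_sum fun x hx => mul_le_mul_of_nonneg_right (hM x hx)
            (mul_nonneg βc.2 (K.exitWeight_nonneg _ _))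
      _ = M * (βc * ∑ x ∈ box d N, K.exitWeight (box d N) x) := by
          simp only [Finset.mul_sum]
      _ ≤ _ := by gcongr
  have h4 := h1.trans (h2.le.trans h3)
  have hNd : (0 : ℝ) < (N : ℝ) ^ d := by positivity
  have hNs : (0 : ℝ) < (N : ℝ) ^ s := by positivity
  have h5 : (N : ℝ) ^ d * (N : ℝ) ^ s ≤ (N : ℝ) ^ d * (βc * C * M) := by
    calc _ ≤ M * (βc * (C * ((N : ℝ) ^ d / (N : ℝ) ^ s))) * (N : ℝ) ^ s := by gcongr
      _ = _ := by field_simp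
  exact le_of_mul_le_mul_left h5 hNd

end PercolationKernel

/-! ### Mean cluster sizes in a box, given the tail of the cluster size -/

section Truncation

variable {V : Type*} [DecidableEq V]

/-- Markov's inequality for the number of vertices in clusters of size at least `n`. -/
theorem mul_prob_hasLargeCluster_le {p : Sym2 V → ℝ} (hp : ∀ e, p e ∈ Set.Icc (0 : ℝ) 1)
    (S : Finset V) (n : ℕ) :
    n * prob p S.sym2 (HasLargeCluster S n)
      ≤ ∑ x ∈ S, prob p S.sym2 (fun X => n ≤ (finCluster X S x).card) := by
  classical
  unfold prob
  rw [← expect_sum, ← expect_const_mul]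
  refine expect_mono hp fun X _ => ?_
  split_ifs with h
  · obtain ⟨x, _, hn⟩ := h
    have hsub : finCluster X S x ⊆ S.filter fun y => n ≤ (finCluster X S y).card := by
      intro y hy
      obtain ⟨hyS, hxy⟩ := mem_finCluster.1 hy
      refine Finset.mem_filter.2 ⟨hyS, hn.trans (Finset.card_le_card fun z hz => ?_)⟩
      obtain ⟨hzS, hxz⟩ := mem_finCluster.1 hz
      exact mem_finCluster.2 ⟨hzS, hxy.symm.trans hxz⟩
    have h1 := hn.trans (Finset.card_le_card hsub)
    rw [mul_one]
    have hcount : (∑ y ∈ S, if n ≤ (finCluster X S y).card then (1 : ℝ) else 0)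
        = (S.filter fun y => n ≤ (finCluster X S y).card).card := by simp
    have h2 : (n : ℝ) ≤ (S.filter fun y => n ≤ (finCluster X S y).card).card := by
      exact_mod_cast h1
    rw [← hcount] at h2
    convert h2
  · rw [mul_zero]
    exact Finset.sum_nonneg fun x _ => by split_ifs <;> norm_num

/-- The layer-cake formula for the mean cluster size, truncated at size `L`. -/
theorem meanSize_le_sum_add {p : Sym2 V → ℝ} (hp : ∀ e, p e ∈ Set.Icc (0 : ℝ) 1)
    (S : Finset V) {x : V} (hx : x ∈ S) (L : ℕ) :
    meanSize p S x ≤ ∑ j ∈ Finset.range L,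
        prob p S.sym2 (fun X => j + 1 ≤ (finCluster X S x).card)
      + S.card * prob p S.sym2 (HasLargeCluster S L) := by
  classical
  rw [meanSize_eq_expect]
  unfold prob
  rw [← expect_sum, ← expect_const_mul, ← expect_add]
  refine expect_mono hp fun X _ => ?_
  have hcount : (∑ j ∈ Finset.range L, if j + 1 ≤ (finCluster X S x).card then (1 : ℝ) else 0)
      = ((Finset.range L).filter fun j => j + 1 ≤ (finCluster X S x).card).card := by simp
  suffices h : ((finCluster X S x).card : ℝ)
      ≤ ((Finset.range L).filter fun j => j + 1 ≤ (finCluster X S x).card).card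
        + S.card * (if HasLargeCluster S L X then 1 else 0) by
    rw [← hcount] at h
    convert h
  by_cases h : L ≤ (finCluster X S x).card
  · rw [if_pos ⟨x, hx, h⟩, mul_one]
    have : ((finCluster X S x).card : ℝ) ≤ S.card := by
      exact_mod_cast Finset.card_le_card (finCluster_subset X S x)
    have h0 : (0 : ℝ) ≤ ((Finset.range L).filter
      fun j => j + 1 ≤ (finCluster X S x).card).card := Nat.cast_nonneg _
    exact this.trans (le_add_of_nonneg_left h0)
  · have h1 : (Finset.range (finCluster X S x).card) ⊆ (Finset.range L).filter
        fun j => j + 1 ≤ (finCluster X S x).card := by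
      intro j hj
      rw [Finset.mem_range] at hj
      exact Finset.mem_filter.2 ⟨Finset.mem_range.2 (by omega), hj⟩
    have h2 := Finset.card_le_card h1
    rw [Finset.card_range] at h2
    have h3 : (0 : ℝ) ≤ S.card * (if HasLargeCluster S L X then 1 else 0) := by
      split_ifs <;> simp
    exact ((Nat.cast_le (α := ℝ)).2 h2).trans (le_add_of_nonneg_right h3)

end Truncation

theorem sum_range_rpow_neg_le {a : ℝ} (ha0 : 0 < a) (ha1 : a < 1) (L : ℕ) :
    ∑ j ∈ Finset.range L, ((j + 1 : ℕ) : ℝ) ^ (-a) ≤ (L : ℝ) ^ (1 - a) / (1 - a) := by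
  induction L with
  | zero => simp [Real.zero_rpow (sub_pos.2 ha1).ne']
  | succ L ih =>
    rw [Finset.sum_range_succ]
    have ha : 0 < 1 - a := sub_pos.2 ha1
    have hL : (0 : ℝ) < ((L + 1 : ℕ) : ℝ) := by positivity
    have hb : (L : ℝ) ^ (1 - a)
        ≤ ((L + 1 : ℕ) : ℝ) ^ (1 - a) - (1 - a) * ((L + 1 : ℕ) : ℝ) ^ (-a) := by
      have h1 : (L : ℝ) = ((L + 1 : ℕ) : ℝ) * (1 + -(1 / ((L + 1 : ℕ) : ℝ))) := by
        field_simp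
        push_cast
        ring
      have h2 : 1 / ((L + 1 : ℕ) : ℝ) ≤ 1 := by
        rw [div_le_one hL]
        push_cast
        linarith [(Nat.cast_nonneg L : (0 : ℝ) ≤ L)]
      have h3 := _root_.rpow_one_add_le_one_add_mul_self (s := -(1 / ((L + 1 : ℕ) : ℝ)))
        (p := 1 - a) (by linarith) ha.le (by linarith)
      have h4 : ((L + 1 : ℕ) : ℝ) ^ (-a)
          = ((L + 1 : ℕ) : ℝ) ^ (1 - a) * (1 / ((L + 1 : ℕ) : ℝ)) := by
        rw [show -a = (1 - a) - 1 by ring, Real.rpow_sub_one hL.ne']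
        ring
      calc (L : ℝ) ^ (1 - a)
          = ((L + 1 : ℕ) : ℝ) ^ (1 - a) * (1 + -(1 / ((L + 1 : ℕ) : ℝ))) ^ (1 - a) := by
            rw [← Real.mul_rpow hL.le (by linarith), ← h1]
        _ ≤ ((L + 1 : ℕ) : ℝ) ^ (1 - a) * (1 + (1 - a) * -(1 / ((L + 1 : ℕ) : ℝ))) := by
            gcongr
        _ = _ := by rw [h4]; ring
    rw [le_div_iff₀ ha] at ih ⊢
    linarith

namespace PercolationKernel

variable {d : ℕ} (K : PercolationKernel d)

theorem clusterTail_le_one (β : ℝ≥0) (n : ℕ) : K.clusterTail β n ≤ 1 := measureReal_le_one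

/-- If the tail of the cluster size is at most of order `n^{-a}` and `m > d / (1 + a)`, then the
mean cluster sizes inside a box of side `N` are at most of order `N^{m (1 - a)}`: the expected
number of clusters of size `N^m` is a negative power of `N`, hence by repeated splitting clusters
of size `3^k N^m` are too unlikely to contribute. -/
theorem exists_meanSize_box_le (β : ℝ≥0) {a A m : ℝ} (ha0 : 0 < a) (ha1 : a < 1) (hA : 0 ≤ A)
    (hm : (d : ℝ) / (1 + a) < m)
    (htail : ∀ n : ℕ, 1 ≤ n → K.clusterTail β n ≤ A * (n : ℝ) ^ (-a)) :
    ∃ C : ℝ, 0 ≤ C ∧ ∀ N : ℕ, 1 ≤ N → ∀ x ∈ box d N,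
      meanSize (K.edgeWeight β) (box d N) x ≤ C * (N : ℝ) ^ (m * (1 - a)) := by
  have ha : 0 < 1 - a := sub_pos.2 ha1
  have hm0 : 0 < m := lt_of_le_of_lt (by positivity) hm
  have hc : 0 < m * (1 + a) - d := by
    rw [div_lt_iff₀ (by linarith)] at hm
    linarith
  -- After `k` triplings the probability bound `N^{-c}`, `c = m (1 + a) - d`, has become
  -- `N^{-c 2^k} ≤ N^{-d}`.
  obtain ⟨k, hk⟩ := pow_unbounded_of_one_lt ((d : ℝ) / (m * (1 + a) - d)) one_lt_two
  rw [div_lt_iff₀ hc] at hk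
  refine ⟨A * ((3 ^ k * 2 : ℝ) ^ (1 - a) / (1 - a)) + A ^ 2 ^ k, by positivity, fun N hN x hx => ?_⟩
  have hN1 : (1 : ℝ) ≤ N := by exact_mod_cast hN
  have hN0 : (0 : ℝ) < N := by linarith
  have hNm : 1 ≤ (N : ℝ) ^ m := Real.one_le_rpow hN1 hm0.le
  set M := ⌈(N : ℝ) ^ m⌉₊ with hM
  have hM1 : (N : ℝ) ^ m ≤ M := Nat.le_ceil _
  have hM2 : (M : ℝ) ≤ 2 * (N : ℝ) ^ m := by
    have := Nat.ceil_lt_add_one (by positivity : 0 ≤ (N : ℝ) ^ m)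
    linarith
  have hM0 : (0 : ℝ) < M := by linarith
  have hMn : 1 ≤ M := by exact_mod_cast hM0
  have hp := K.edgeWeight_mem β
  have hbase : prob (K.edgeWeight β) (box d N).sym2 (HasLargeCluster (box d N) M)
      ≤ A * (N : ℝ) ^ (-(m * (1 + a) - d)) := by
    have h1 := mul_prob_hasLargeCluster_le hp (box d N) M
    have h2 : ∑ x ∈ box d N, prob (K.edgeWeight β) (box d N).sym2
        (fun X => M ≤ (finCluster X (box d N) x).card) ≤ (N : ℝ) ^ d * (A * (M : ℝ) ^ (-a)) := by
      calc _ ≤ ∑ _x ∈ box d N, A * (M : ℝ) ^ (-a) := Finset.sum_le_sum fun x _ =>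
            (K.prob_card_finCluster_le β _ x M).trans (htail M hMn)
        _ = _ := by rw [Finset.sum_const, card_box, nsmul_eq_mul]; push_cast; ring
    have h3 : prob (K.edgeWeight β) (box d N).sym2 (HasLargeCluster (box d N) M)
        ≤ (N : ℝ) ^ d * (A * (M : ℝ) ^ (-a)) / M := by
      rw [le_div_iff₀ hM0]
      linarith
    have h4 : (N : ℝ) ^ d * (A * (M : ℝ) ^ (-a)) / M = A * ((N : ℝ) ^ d * (M : ℝ) ^ (-a - 1)) := by
      rw [Real.rpow_sub_one hM0.ne']
      ring
    have h5 : (M : ℝ) ^ (-a - 1) ≤ ((N : ℝ) ^ m) ^ (-a - 1) :=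
      Real.rpow_le_rpow_of_nonpos (by linarith) hM1 (by linarith)
    rw [h4] at h3
    refine h3.trans (mul_le_mul_of_nonneg_left ?_ hA)
    calc (N : ℝ) ^ d * (M : ℝ) ^ (-a - 1) ≤ (N : ℝ) ^ (d : ℝ) * ((N : ℝ) ^ m) ^ (-a - 1) := by
          rw [Real.rpow_natCast]
          gcongr
      _ = _ := by
          rw [← Real.rpow_mul hN0.le, ← Real.rpow_add hN0]
          ring_nf
  have hlarge : ((box d N).card : ℝ)
      * prob (K.edgeWeight β) (box d N).sym2 (HasLargeCluster (box d N) (3 ^ k * M))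
      ≤ A ^ 2 ^ k := by
    have h1 := (prob_hasLargeCluster_three_pow_mul_le hp (box d N) hMn k).trans
      (pow_le_pow_left₀ (prob_nonneg hp _ _) hbase _)
    rw [mul_pow, ← Real.rpow_natCast ((N : ℝ) ^ _), ← Real.rpow_mul hN0.le] at h1
    have h2 : (N : ℝ) ^ (-(m * (1 + a) - d) * ((2 ^ k : ℕ) : ℝ)) ≤ (N : ℝ) ^ (-(d : ℝ)) := by
      refine Real.rpow_le_rpow_of_exponent_le hN1 ?_
      push_cast
      nlinarith
    rw [card_box]
    push_cast
    calc (N : ℝ) ^ d * prob (K.edgeWeight β) (box d N).sym2 (HasLargeCluster (box d N) (3 ^ k * M))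
        ≤ (N : ℝ) ^ d * (A ^ 2 ^ k * (N : ℝ) ^ (-(d : ℝ))) := by
          gcongr
          exact h1.trans (by gcongr)
      _ = A ^ 2 ^ k := by
          rw [Real.rpow_neg hN0.le, Real.rpow_natCast]
          field_simp
  have hsmall : ∑ j ∈ Finset.range (3 ^ k * M), prob (K.edgeWeight β) (box d N).sym2
        (fun X => j + 1 ≤ (finCluster X (box d N) x).card)
      ≤ A * ((3 ^ k * 2 : ℝ) ^ (1 - a) / (1 - a)) * (N : ℝ) ^ (m * (1 - a)) := by
    calc _ ≤ ∑ j ∈ Finset.range (3 ^ k * M), A * ((j + 1 : ℕ) : ℝ) ^ (-a) :=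
          Finset.sum_le_sum fun j _ => (K.prob_card_finCluster_le β _ x (j + 1)).trans
            (htail (j + 1) (Nat.succ_pos j))
      _ ≤ A * (((3 ^ k * M : ℕ) : ℝ) ^ (1 - a) / (1 - a)) := by
          rw [← Finset.mul_sum]
          exact mul_le_mul_of_nonneg_left (sum_range_rpow_neg_le ha0 ha1 _) hA
      _ ≤ A * (((3 ^ k * 2) * (N : ℝ) ^ m) ^ (1 - a) / (1 - a)) := by
          have : ((3 ^ k * M : ℕ) : ℝ) ≤ (3 ^ k * 2) * (N : ℝ) ^ m := by
            push_cast
            rw [mul_assoc]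
            gcongr
          gcongr
      _ = _ := by
          rw [Real.mul_rpow (by positivity) (by positivity), ← Real.rpow_mul hN0.le]
          ring
  have h1 : (1 : ℝ) ≤ (N : ℝ) ^ (m * (1 - a)) := Real.one_le_rpow hN1 (by positivity)
  have h2 : A ^ 2 ^ k ≤ A ^ 2 ^ k * (N : ℝ) ^ (m * (1 - a)) :=
    le_mul_of_one_le_right (by positivity) h1
  refine (meanSize_le_sum_add hp (box d N) hx (3 ^ k * M)).trans ?_
  rw [add_mul]
  exact add_le_add hsmall (hlarge.trans h2)

/-! ### The exponent inequality -/

theorem le_of_forall_rpow_le {s t C : ℝ} (h : ∀ N : ℕ, 1 ≤ N → (N : ℝ) ^ s ≤ C * (N : ℝ) ^ t) :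
    s ≤ t := by
  by_contra! hlt
  have h1 : Tendsto (fun N : ℕ => (N : ℝ) ^ (s - t)) atTop atTop :=
    (tendsto_rpow_atTop (sub_pos.2 hlt)).comp tendsto_natCast_atTop_atTop
  obtain ⟨N, hN1, hN⟩ := ((eventually_ge_atTop 1).and (h1.eventually_gt_atTop C)).exists
  have hN0 : (0 : ℝ) < N := by exact_mod_cast hN1
  rw [Real.rpow_sub hN0, lt_div_iff₀ (by positivity)] at hN
  exact absurd (h N hN1) (not_le.2 hN)

/-- A tail bound of order `n^{-a}` at criticality forces `a ≤ (d - s) / (d + s)` for every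
`s < min α 1`. -/
theorem mul_le_of_clusterTail_le {α C₁ : ℝ} (hJ : ∀ x y : Fin d → ℤ, x ≠ y →
      (K.J x y : ℝ) ≤ C₁ * euclNorm (x - y) ^ (-(d : ℝ) - α))
    {βc : ℝ≥0} (hβc : K.criticalParameter = (βc : ℝ≥0∞)) {s a A : ℝ} (hs0 : 0 < s) (hs1 : s ≤ 1)
    (hsα : s < α) (ha0 : 0 < a) (ha1 : a < 1) (hA : 0 ≤ A)
    (htail : ∀ n : ℕ, 1 ≤ n → K.clusterTail βc n ≤ A * (n : ℝ) ^ (-a)) :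
    s * (1 + a) ≤ d * (1 - a) := by
  have ha : 0 < 1 - a := sub_pos.2 ha1
  by_contra! hlt
  have hgap : (d : ℝ) / (1 + a) < s / (1 - a) := by
    rw [div_lt_div_iff₀ (by linarith) ha]
    exact hlt
  obtain ⟨m, hm1, hm2⟩ := exists_between hgap
  obtain ⟨B, hB0, hB⟩ := K.exists_sum_exitWeight_box_le hs0 hs1 hsα hJ
  obtain ⟨C, hC0, hC⟩ := K.exists_meanSize_box_le βc ha0 ha1 hA hm1 htail
  have h := le_of_forall_rpow_le (s := s) (t := m * (1 - a)) (C := βc * B * C) fun N hN => by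
    have h1 := K.rpow_le_of_meanSize_box_le hβc hN (hB N hN) (hC N hN) (by positivity)
    rwa [← mul_assoc] at h1
  rw [lt_div_iff₀ ha] at hm2
  linarith

/-- The definition allows negative exponents, but these contradict `ℙ(|K_0| ≥ n) ≤ 1`. -/
theorem IsClusterExponent.pos {K : PercolationKernel d} {β : ℝ≥0} {δ : ℝ}
    (h : K.IsClusterExponent β δ) : 0 < δ := by
  obtain ⟨hδ, ε, hε, hev⟩ := h
  by_contra! hle
  have hneg : δ < 0 := lt_of_le_of_ne hle hδ
  have hc : 0 < -1 / δ := div_pos_of_neg_of_neg (by norm_num) hneg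
  have h1 : ∀ᶠ n in atTop, -(-1 / δ) < ε n := hε.eventually_const_lt (by linarith)
  obtain ⟨n, h1, h2, hn⟩ := (h1.and (hev.and (eventually_gt_atTop 1))).exists
  have h3 : (1 : ℝ) < (n : ℝ) ^ (-1 / δ + ε n) :=
    Real.one_lt_rpow (by exact_mod_cast hn) (by linarith)
  rw [← h2] at h3
  exact absurd (K.clusterTail_le_one β n) (not_le.2 h3)

/-- The `o(1)` in the exponent is absorbed by decreasing `1 / δ` to `a`. -/
theorem IsClusterExponent.exists_clusterTail_le {K : PercolationKernel d} {β : ℝ≥0} {δ a : ℝ}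
    (h : K.IsClusterExponent β δ) (ha0 : 0 < a) (ha : a < 1 / δ) :
    ∃ A : ℝ, 0 ≤ A ∧ ∀ n : ℕ, 1 ≤ n → K.clusterTail β n ≤ A * (n : ℝ) ^ (-a) := by
  obtain ⟨-, ε, hε, hev⟩ := h
  have h1 : ∀ᶠ n in atTop, ε n < 1 / δ - a := hε.eventually_lt_const (by linarith)
  obtain ⟨n₀, hn₀⟩ := eventually_atTop.1 (h1.and hev)
  refine ⟨((n₀ + 1 : ℕ) : ℝ) ^ a, by positivity, fun n hn => ?_⟩
  have hn0 : (1 : ℝ) ≤ n := by exact_mod_cast hn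
  have hpos : (0 : ℝ) < n := by linarith
  rcases le_total n₀ n with h | h
  · obtain ⟨h2, h3⟩ := hn₀ n h
    have hA1 : (1 : ℝ) ≤ ((n₀ + 1 : ℕ) : ℝ) ^ a :=
      Real.one_le_rpow (by push_cast; linarith [(Nat.cast_nonneg n₀ : (0 : ℝ) ≤ n₀)]) ha0.le
    rw [h3]
    refine le_trans ?_ (le_mul_of_one_le_left (by positivity) hA1)
    refine Real.rpow_le_rpow_of_exponent_le hn0 ?_
    have : -1 / δ = -(1 / δ) := by ring
    linarith
  · refine (K.clusterTail_le_one β n).trans ?_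
    rw [Real.rpow_neg hpos.le, ← div_eq_mul_inv, one_le_div (by positivity)]
    refine Real.rpow_le_rpow hpos.le ?_ ha0.le
    exact_mod_cast h.trans (Nat.le_succ n₀)

end PercolationKernel

theorem theorem1p1 (d : ℕ) (hd : 1 ≤ d) (α : ℝ) (hα : 0 < α) (hα₁ : d = 1 → α < 1)
    (K : PercolationKernel d) (C₁ : ℝ)
    (hJ : ∀ x y : Fin d → ℤ, x ≠ y →
      (K.J x y : ℝ) ≤ C₁ * euclNorm (x - y) ^ (-(d : ℝ) - α))
    (βc : ℝ≥0) (hβc : K.criticalParameter = (βc : ℝ≥0∞)) :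
    (∀ δ : ℝ, K.IsClusterExponent βc δ →
      ((d : ℝ) + min α 1) / ((d : ℝ) - min α 1) ≤ δ) ∧
    ((d = 1 ∨ d = 2) → (d : ℝ) / 3 < α → ¬ K.HasMeanFieldExponent βc) := by
  have hs0 : 0 < min α 1 := lt_min hα one_pos
  have hds : min α 1 < (d : ℝ) := by
    rcases hd.eq_or_lt with h | h
    · have h1 := hα₁ h.symm
      rw [← h]
      exact (min_le_left _ _).trans_lt (by exact_mod_cast h1)
    · exact (min_le_right _ _).trans_lt (by exact_mod_cast h)
  have main : ∀ δ : ℝ, K.IsClusterExponent βc δ →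
      ((d : ℝ) + min α 1) / ((d : ℝ) - min α 1) ≤ δ := by
    intro δ hδ
    have hδ0 := hδ.pos
    by_contra! hlt
    rw [lt_div_iff₀ (by linarith)] at hlt
    have h1 : ((d : ℝ) - min α 1) / (d + min α 1) < min (1 / δ) 1 := by
      refine lt_min ?_ ?_
      · rw [div_lt_div_iff₀ (by linarith) hδ0]
        linarith
      · rw [div_lt_one (by linarith)]
        linarith
    -- A tail bound with an exponent `a < 1 / δ` suffices; `a < 1` covers the case `δ ≤ 1` too.
    obtain ⟨a, ha1, ha2⟩ := exists_between h1
    have ha0 : 0 < a := lt_trans (div_pos (by linarith) (by linarith)) ha1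
    have haδ := ha2.trans_le (min_le_left _ _)
    have hal := ha2.trans_le (min_le_right _ _)
    rw [div_lt_iff₀ (by linarith)] at ha1
    have h2 : (d : ℝ) * (1 - a) / (1 + a) < min α 1 := by
      rw [div_lt_iff₀ (by linarith)]
      linarith
    obtain ⟨s, hs1, hs2⟩ := exists_between h2
    have hspos : 0 < s := lt_of_le_of_lt
      (div_nonneg (mul_nonneg (Nat.cast_nonneg d) (by linarith)) (by linarith)) hs1
    obtain ⟨A, hA, htail⟩ := hδ.exists_clusterTail_le ha0 haδ
    have h3 := K.mul_le_of_clusterTail_le hJ hβc hspos (hs2.le.trans (min_le_right _ _))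
      (hs2.trans_le (min_le_left _ _)) ha0 hal hA htail
    rw [div_lt_iff₀ (by linarith)] at hs1
    linarith
  refine ⟨main, fun hd12 hαd hmf => ?_⟩
  have h := main 2 hmf
  rw [div_le_iff₀ (by linarith)] at h
  have h3 : (d : ℝ) / 3 < min α 1 := by
    refine lt_min hαd ?_
    rcases hd12 with rfl | rfl <;> norm_num
  linarith
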